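/- Notation. $C^\infty([0,\infty])$ is the set of $\chi:[0,\infty]\to\mathbb C$ such that $t\mapsto\chi(t)$ and $s\mapsto\chi(1/s)$ are smooth on $[0,\infty)$; $\chi$ vanishes to order $k\ge 0$ at $0$ if $\chi^{(i)}(0)=0$ for all $i<k$. $\mathscr D_{p,q}(\mathbb C^n)$ is the space of smooth compactly supported $(p,q)$-forms, $|\gamma|=(\sum_j\gamma_j^2)^{1/2}$ for a multiindex $\gamma\in\mathbb N^n$, and $1/|\gamma|=+\infty$ if $\gamma=0$. The principal value current $[1/\zeta^\gamma]$ is $[1/\zeta^\gamma].\psi=\lim_{\delta\to0^+}\int_{|\zeta^\gamma|^2>\delta}\psi/\zeta^\gamma$, and $\bar\partial[1/\zeta^\gamma].\psi=-[1/\zeta^\gamma].\bar\partial\psi$. Integrals of $(n,n)$-forms are taken with respect to the orientation for which $(i/2)^n d\zeta_1\wedge d\bar\zeta_1\wedge\cdots\wedge d\zeta_n\wedge d\bar\zeta_n$ is Lebesgue measure. Statement. Let $k,\ell\ge 0$ be integers, and let $\chi_1,\chi_2\in C^\infty([0,\infty])$ vanish to orders $k$ and $\ell$ at $0$, respectively,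 and satisfy $\chi_1(\infty)=\chi_2(\infty)=1$. Let $\alpha',\alpha'',\beta',\beta''\in\mathbb N^n$ be multiindices such that $\alpha',\alpha'',\beta'$ have pairwise disjoint supports and $\alpha''_j=0$ if and only if $\beta''_j=0$. Put $\mu_1=\zeta^{\alpha'+\alpha''}$ and $\mu_2=\zeta^{\beta'+\beta''}$. Let $\varphi\in\mathscr D_{n,n-1}(\mathbb C^n)$ be such that $\frac{d\bar\zeta_j}{\bar\zeta_j}\wedge\varphi$ extends to an element of $\mathscr D_{n,n}(\mathbb C^n)$ for every $j$ with $\alpha''_j\ne0$, and let $\Phi,\Psi$ be smooth strictly positive functions on $\mathbb C^n$. Then for all $\epsilon_1,\epsilon_2>0$ the integral $$I(\epsilon_1,\epsilon_2)=\int\frac{1}{\mu_1^k\mu_2^\ell}\,\chi_1(\Phi|\mu_1|^2/\epsilon_1)\,\bar\partial\chi_2(\Psi|\mu_2|^2/\epsilon_2)\wedge\varphi$$ converges absolutely, and $$\lim_{\epsilon_1,\epsilon_2\to0^+}I(\epsilon_1,\epsilon_2)=\Big[\frac1{\mu_1^k\zeta^{\ell\beta''}}\Big]\otimes\bar\partial\Big[\frac1{\zeta^{\ell\beta'}}\Big].\varphi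 ,$$ where the right-hand side is the tensor product of the current $\bar\partial[1/\zeta^{\ell\beta'}]$ in the variables $\zeta_j$ with $\beta'_j\neq0$ and the current $[1/(\mu_1^k\zeta^{\ell\beta''})]$ in the remaining variables (all limits defining these currents exist). Moreover, $I$ extends to a function on $[0,\infty)^2$, whose value at $(0,0)$ is this limit, and which is $\omega$-Hölder continuous on $[0,\infty)^2$ for every $0<\omega\le1$ with $2\omega<\min\{|\alpha'+\alpha''|^{-1},|\beta'+\beta''|^{-1}\}$. -/

import Mathlib

open Filter Topology MeasureTheory Set
open scoped ContDiff ENNReal NNReal ComplexConjugate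

namespace ResidueReg

/-- The class `C^∞([0,∞])`: `χ` is smooth on `[0,∞)` and `s ↦ χ (1/s)` is smooth on `[0,∞)`
(in `ℝ≥0∞` one has `0⁻¹ = ⊤`, so the value of the second function at `s = 0` is `χ ⊤`). -/
def SmoothExt (χ : ℝ≥0∞ → ℂ) : Prop :=
  ContDiffOn ℝ ∞ (fun t : ℝ => χ (ENNReal.ofReal t)) (Ici 0) ∧
    ContDiffOn ℝ ∞ (fun s : ℝ => χ (ENNReal.ofReal s)⁻¹) (Ici 0)

/-- `χ` vanishes to order `k` at `0`: all (one-sided) derivatives of order `< k` vanish there. -/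
def VanishesToOrder (χ : ℝ≥0∞ → ℂ) (k : ℕ) : Prop :=
  ∀ i < k, iteratedDerivWithin i (fun t : ℝ => χ (ENNReal.ofReal t)) (Ici 0) 0 = 0

section

variable {ι : Type*} [Fintype ι]

/-- The monomial `ζ^γ`. -/
def monom (γ : ι → ℕ) (z : ι → ℂ) : ℂ := ∏ j, z j ^ γ j

/-- The Euclidean length `|γ|` of a multiindex. -/
noncomputable def mlength (γ : ι → ℕ) : ℝ := Real.sqrt (∑ j, (γ j : ℝ) ^ 2)

/-- The coefficients `∂u/∂ζ̄_j = (∂u/∂x_j + i ∂u/∂y_j) / 2` of `∂̄u = ∑_j (∂u/∂ζ̄_j) dζ̄_j`. -/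
noncomputable def dbar [DecidableEq ι] (u : (ι → ℂ) → ℂ) (j : ι) (z : ι → ℂ) : ℂ :=
  (fderiv ℝ u z (Pi.single j 1) + Complex.I * fderiv ℝ u z (Pi.single j Complex.I)) / 2

/-- The function `f` is (the coefficient of) a test form `f dV` of bidegree `(n,n)`, where
`dV = (i/2)^n dζ_1 ∧ dζ̄_1 ∧ ⋯ ∧ dζ_n ∧ dζ̄_n` is the volume form. The integral of the form `f dV` is
the Lebesgue integral of `f`. -/
def IsTopTestForm (f : (ι → ℂ) → ℂ) : Prop := ContDiff ℝ ∞ f ∧ HasCompactSupport f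

variable (ι) in
/-- A test form `φ` of bidegree `(n,n-1)` on `ℂ^ι`, `n = #ι`, written as `φ = ∑_j φ_j θ_j`. Here
`θ_j` is the `(n,n-1)`-form with constant coefficients such that `dζ̄_j ∧ θ_j = dV` and
`dζ̄_i ∧ θ_j = 0` for `i ≠ j`; these forms are a basis of the forms of bidegree `(n,n-1)`. -/
structure TestForm where
  coeff : ι → (ι → ℂ) → ℂ
  smooth : ∀ j, ContDiff ℝ ∞ (coeff j)
  compact : ∀ j, HasCompactSupport (coeff j)

/-- The coefficient with respect to `dV` of `a ∧ φ`, for a `(0,1)`-form `a = ∑_j a_j dζ̄_j`. -/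
def wedge (a : ι → (ι → ℂ) → ℂ) (φ : TestForm ι) (z : ι → ℂ) : ℂ :=
  ∑ j, a j z * φ.coeff j z

/-- The `(0,1)`-form `dζ̄_j / ζ̄_j`, defined where `ζ_j ≠ 0`. -/
noncomputable def dlogBar [DecidableEq ι] (j : ι) (i : ι) (z : ι → ℂ) : ℂ :=
  if i = j then (conj (z j))⁻¹ else 0

/-- The form `dζ̄_j / ζ̄_j ∧ φ`, which is defined where `ζ_j ≠ 0`, is (extends to) a test form
of bidegree `(n,n)`. -/
def DlogBarWedgeIsTest [DecidableEq ι] (φ : TestForm ι) (j : ι) : Prop :=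
  ∃ h : (ι → ℂ) → ℂ, IsTopTestForm h ∧ ∀ z, z j ≠ 0 → h z = wedge (dlogBar j) φ z

/-- `[1/ζ^γ].ψ dV = L` for the principal value current
`[1/f].ψ dV = lim_{δ → 0⁺} ∫_{|f|² > δ} ψ / f dV` with `f = ζ^γ` (the limit exists and is `L`). -/
def HasPrincipalValue (γ : ι → ℕ) (ψ : (ι → ℂ) → ℂ) (L : ℂ) : Prop :=
  Tendsto (fun δ : ℝ => ∫ z in {z : ι → ℂ | δ < ‖monom γ z‖ ^ 2}, ψ z / monom γ z)
    (𝓝[>] 0) (𝓝 L)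

/-- `∂̄[1/ζ^γ].ψ = L` for the form `ψ = ∑_j ψ_j θ_j` of bidegree `(n,n-1)`, with
`∂̄T.ψ = -T.∂̄ψ` and `∂̄ψ = (∑_j ∂ψ_j/∂ζ̄_j) dV`. -/
def HasResidue [DecidableEq ι] (γ : ι → ℕ) (ψ : ι → (ι → ℂ) → ℂ) (L : ℂ) : Prop :=
  HasPrincipalValue γ (fun z => ∑ j, dbar (ψ j) j z) (-L)

variable (p : ι → Prop) [DecidablePred p]

/-- The point of `ℂ^ι` with coordinates `x_j` for `j` in `p` and `y_j` for the other `j`. -/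
def glue (x : {j // p j} → ℂ) (y : {j // ¬ p j} → ℂ) (j : ι) : ℂ :=
  if h : p j then x ⟨j, h⟩ else y ⟨j, h⟩

/-- `([1/ζ^a] ⊗ ∂̄[1/ζ^b]).φ = L`, where the current `[1/ζ^a]` lives in the variables `x` with index
in `p` and `∂̄[1/ζ^b]` in the other variables `y`. As always, `(S ⊗ T).φ = S_x.(T_y.φ(x,y))`. Only the
components `φ_j θ_j` with `j` not in `p` have full degree in `x`, so only these contribute, and there
`θ_j` is the product of the volume form in `x` and the form `θ_j` in `y`. -/
def HasTensorResidue [DecidableEq ι] (a b : ι → ℕ) (φ : TestForm ι) (L : ℂ) : Prop :=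
  ∃ v : ({j // p j} → ℂ) → ℂ,
    (∀ x, HasResidue (fun j : {j // ¬ p j} => b j) (fun j y => φ.coeff j (glue p x y)) (v x)) ∧
    HasPrincipalValue (fun j : {j // p j} => a j) v L

end

section

variable {n : ℕ}

/-- The function `ζ ↦ χ(Φ |ζ^γ|² / ε)`, `ε > 0`. -/
noncomputable def cutoff (χ : ℝ≥0∞ → ℂ) (Φ : (Fin n → ℂ) → ℝ) (γ : Fin n → ℕ) (ε : ℝ)
    (z : Fin n → ℂ) : ℂ :=
  χ (ENNReal.ofReal (Φ z * ‖monom γ z‖ ^ 2 / ε))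

/-- The coefficient with respect to `dV` of the `(n,n)`-form
`1/(μ₁^k μ₂^ℓ) χ₁(Φ|μ₁|²/ε₁) ∂̄χ₂(Ψ|μ₂|²/ε₂) ∧ φ`, where `μ₁ = ζ^α` and `μ₂ = ζ^β`. -/
noncomputable def integrand (χ₁ χ₂ : ℝ≥0∞ → ℂ) (k l : ℕ) (Φ Ψ : (Fin n → ℂ) → ℝ)
    (α β : Fin n → ℕ) (φ : TestForm (Fin n)) (ε : ℝ × ℝ) (z : Fin n → ℂ) : ℂ :=
  1 / (monom α z ^ k * monom β z ^ l) * cutoff χ₁ Φ α ε.1 z *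
    wedge (dbar (cutoff χ₂ Ψ β ε.2)) φ z

end

end ResidueReg

/-!
Write `μ₁ = ζ^α`, `μ₂ = ζ^β` with `α = α' + α''`, `β = β' + β''`, and `a_i(s) = χ_i(1/s)`, which is
a smooth function on `[0,∞)` of size `O((1+s)^{-k})`, resp. `O((1+s)^{-l})` (`IsSymbol`). The
cutoff functions are `a₁(s₁/Φ)` and `a₂(s₂/Ψ)` with `s = (ε₁/|μ₁|², ε₂/|μ₂|²)`.

*Reduction.* The form `∂̄χ₂(Ψ|μ₂|²/ε₂) ∧ φ` is the sum of the terms `∂χ₂/∂ζ̄_j φ_j`. If `β'_j = 0`,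
the derivative of the cutoff function is `-(s a₂')(s₂/Ψ) (∂̄_jΨ/Ψ + β''_j/ζ̄_j)`, and the pole
`1/ζ̄_j` is absorbed by `φ_j`. If `β'_j ≠ 0`, the derivative is moved to the other factors by an
integration by parts; as `μ₁` does not depend on `ζ_j`, the derivative of `χ₁(Φ|μ₁|²/ε₁)` produces no
pole. So the integral is a combination of integrals of the form
`∫ c / (μ₁^k μ₂^l) a₁(s₁/Φ) a₂(s₂/Ψ)` with symbols `a₁`, `a₂` and a test function `c`
(`integrand_eq`). All of them but the one with `c = -∑ ∂φ_j/∂ζ̄_j` contain an Euler derivative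
`s a_i'(s)` in place of `a₁` or `a₂`, which vanishes at `s = 0`.

*Regularized integrals.* For fixed `s` let `G_s(ζ) = c(ζ) a₁(s₁/Φ(ζ)) a₂(s₂/Ψ(ζ))`. The variable `s`
depends only on the absolute values `|ζ_j|`, so that the integrand `ζ^{-M} G_s`, `M = kα + lβ`, may be
replaced by its average over a group of rotations of the coordinates. It suffices to use the
`N`-th roots of unity, for `N` large. The average picks out the component of `G_s` of weight `M`,
which is `O(|ζ^M|)` with a constant given by derivatives of `G_s` (`norm_torusSum_le`). These are
bounded and Hölder continuous in `s ∈ [0,∞)²` (`IsAmplitude.exists_derivBound`). Hence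
the averages `torusMean` are bounded, and Hölder continuous in `s` with every exponent `r ≤ 1`; as
`|μ₁|^{-2r}` and `|μ₂|^{-2r}` are locally integrable if `r α_j < 1` and `r β_j < 1` for all `j`, the
integrals extend to `ε ∈ [0,∞)²` as `r`-Hölder continuous functions for these `r`
(`exists_regIntegral_holder`).

*The limit.* At `ε = 0` only the integral of `torusMean` of `-∑ ∂φ_j/∂ζ̄_j` remains, where the sum
is over the `j` with `β'_j ≠ 0`, since `a₁(0) = a₂(0) = 1`. The domains `|ζ^γ|² > δ` are invariant
under rotations as well, so that principal values are integrals of averages too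
(`hasPrincipalValue_of_torusMean`), and Fubini's theorem identifies the limit with the tensor
product (`hasTensorResidue_torusMean`).
-/

set_option linter.unusedSectionVars false

namespace ResidueReg

/-! ### Smooth functions on the half-line -/

/-- The weighted mean `t ↦ ∫₀¹ u^m f(ut) du`. -/
noncomputable def wmean (m : ℕ) (f : ℝ → ℂ) (t : ℝ) : ℂ := ∫ u in (0 : ℝ)..1, u ^ m • f (u * t)

/-- A function that is `C^1` on the half-line extends to a `C^1` function on `ℝ`. -/
lemma exists_hasDerivAt_extension {f : ℝ → ℂ} (hf : ContDiffOn ℝ 1 f (Ici 0)) :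
    ∃ g g' : ℝ → ℂ, Continuous g' ∧ (∀ t, HasDerivAt g (g' t) t) ∧ EqOn g f (Ici 0) ∧
      EqOn g' (derivWithin f (Ici 0)) (Ici 0) := by
  have hc : ContinuousOn (derivWithin f (Ici 0)) (Ici 0) :=
    hf.continuousOn_derivWithin (uniqueDiffOn_Ici 0) le_rfl
  have hc' : Continuous (fun t : ℝ => derivWithin f (Ici 0) (max t 0)) :=
    hc.comp_continuous (by fun_prop) (fun t => le_max_right t 0)
  have hg : ∀ t, HasDerivAt (fun t : ℝ => f 0 + ∫ x in (0 : ℝ)..t, derivWithin f (Ici 0) (max x 0))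
      (derivWithin f (Ici 0) (max t 0)) t := fun t =>
    (intervalIntegral.integral_hasDerivAt_right (hc'.intervalIntegrable _ _)
      (hc'.stronglyMeasurableAtFilter _ _) hc'.continuousAt).const_add _
  refine ⟨_, _, hc', hg, fun t ht => ?_, fun t ht => ?_⟩
  · have ht' : (0 : ℝ) ≤ t := ht
    have h1 : ∫ x in (0 : ℝ)..t, derivWithin f (Ici 0) (max x 0) = f t - f 0 := by
      apply intervalIntegral.integral_eq_sub_of_hasDeriv_right_of_le ht'
        (hf.continuousOn.mono Icc_subset_Ici_self)
      · intro x hx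
        have hx0 : (0 : ℝ) ≤ x := hx.1.le
        rw [max_eq_left hx0]
        exact ((hf.differentiableOn one_ne_zero x hx0).hasDerivWithinAt).mono
          (fun y hy => hx0.trans (le_of_lt hy))
      · exact hc'.intervalIntegrable _ _
    simp only [h1]; ring
  · simp only [max_eq_left (show (0 : ℝ) ≤ t from ht)]

lemma hasDerivWithinAt_wmean {f : ℝ → ℂ} (hf : ContDiffOn ℝ 1 f (Ici 0)) (m : ℕ) {t : ℝ}
    (ht : 0 ≤ t) :
    HasDerivWithinAt (wmean m f) (wmean (m + 1) (derivWithin f (Ici 0)) t) (Ici 0) t := by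
  obtain ⟨g, g', hg'c, hg, hgf, hgf'⟩ := exists_hasDerivAt_extension hf
  have hgc : Continuous g := continuous_iff_continuousAt.2 fun t => (hg t).continuousAt
  have key : ∀ (h h' : ℝ → ℂ) (m : ℕ), EqOn h h' (Ici 0) → ∀ t : ℝ, 0 ≤ t →
      wmean m h t = wmean m h' t := by
    intro h h' m hh t ht
    refine intervalIntegral.integral_congr fun u hu => ?_
    rw [uIcc_of_le zero_le_one] at hu
    simp only [hh (mul_nonneg hu.1 ht : (0 : ℝ) ≤ u * t)]
  obtain ⟨C, hC⟩ := (isCompact_Icc (a := -(|t| + 1)) (b := |t| + 1)).exists_bound_of_continuousOn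
    hg'c.continuousOn
  have hd : HasDerivAt (wmean m g) (wmean (m + 1) g' t) t := by
    refine (intervalIntegral.hasDerivAt_integral_of_dominated_loc_of_deriv_le
      (F := fun t u => u ^ m • g (u * t)) (F' := fun t u => u ^ (m + 1) • g' (u * t))
      (bound := fun _ => C) (Metric.ball_mem_nhds t one_pos) ?_ ?_ ?_ ?_ ?_ ?_).2
    · exact .of_forall fun x => (by fun_prop : Continuous _).aestronglyMeasurable
    · exact (by fun_prop : Continuous _).intervalIntegrable _ _
    · exact (by fun_prop : Continuous _).aestronglyMeasurable
    · refine .of_forall fun u hu x hx => ?_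
      rw [uIoc_of_le zero_le_one] at hu
      rw [Metric.mem_ball, Real.dist_eq] at hx
      have hux : |u * x| ≤ |t| + 1 := by
        rw [abs_mul, abs_of_pos hu.1]
        have : |x| ≤ |t| + 1 := by
          have := abs_sub_abs_le_abs_sub x t
          linarith
        nlinarith [hu.1, hu.2, abs_nonneg x, abs_nonneg t]
      rw [norm_smul, norm_pow, Real.norm_eq_abs, abs_of_pos hu.1]
      have h1 := hC (u * x) (abs_le.1 hux)
      have h2 : u ^ (m + 1) ≤ 1 := pow_le_one₀ hu.1.le hu.2
      calc _ ≤ 1 * ‖g' (u * x)‖ := by gcongr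
        _ ≤ C := by simpa using h1
    · exact intervalIntegrable_const
    · refine .of_forall fun u _ x _ => ?_
      have h1 : HasDerivAt (fun x => g (u * x)) (u • g' (u * x)) x := by
        have := (hg (u * x)).scomp x ((hasDerivAt_id x).const_mul u)
        simpa [Function.comp_def] using this
      have := h1.const_smul (u ^ m)
      rwa [smul_smul, ← pow_succ] at this
  rw [key _ _ _ hgf'.symm t ht]
  exact hd.hasDerivWithinAt.congr (fun x hx => key _ _ _ hgf.symm x hx) (key _ _ _ hgf.symm t ht)

lemma contDiffOn_wmean {f : ℝ → ℂ} (hf : ContDiffOn ℝ ∞ f (Ici 0)) (m : ℕ) :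
    ContDiffOn ℝ ∞ (wmean m f) (Ici 0) := by
  rw [contDiffOn_infty]
  intro n
  induction n generalizing m f with
  | zero =>
    exact contDiffOn_zero.2 fun t ht =>
      (hasDerivWithinAt_wmean (hf.of_le (by simp)) m ht).continuousWithinAt
  | succ n ih =>
    have hd := fun t (ht : t ∈ Ici (0 : ℝ)) =>
      hasDerivWithinAt_wmean (f := f) (hf.of_le (by simp)) m ht
    push_cast
    rw [contDiffOn_succ_iff_derivWithin (uniqueDiffOn_Ici 0)]
    refine ⟨fun t ht => (hd t ht).differentiableWithinAt, by simp, ?_⟩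
    refine (ih ((contDiffOn_infty_iff_derivWithin (uniqueDiffOn_Ici 0)).1 hf).2 (m + 1)).congr
      fun t ht => (hd t ht).derivWithin (uniqueDiffOn_Ici 0 t ht)

/-- Hadamard's lemma on the half-line: a smooth function that vanishes to order `k` at the end
point is divisible by `t^k`. The quotient for `f` comes from the quotient `b` for `f'`, by
`∫₀ᵗ v^k b(v) dv = t^(k+1) ∫₀¹ u^k b(ut) du`. -/
lemma exists_eq_pow_mul {f : ℝ → ℂ} (hf : ContDiffOn ℝ ∞ f (Ici 0)) {k : ℕ}
    (hk : ∀ i < k, iteratedDerivWithin i f (Ici 0) 0 = 0) :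
    ∃ b : ℝ → ℂ, ContDiffOn ℝ ∞ b (Ici 0) ∧ ∀ t, 0 ≤ t → f t = (t : ℂ) ^ k * b t := by
  induction k generalizing f with
  | zero => exact ⟨f, hf, fun t _ => by simp⟩
  | succ k ih =>
    have hf' := ((contDiffOn_infty_iff_derivWithin (uniqueDiffOn_Ici (0 : ℝ))).1 hf).2
    obtain ⟨b, hb, hfb⟩ := ih hf' (fun i hi => by
      rw [← iteratedDerivWithin_succ']; exact hk (i + 1) (by omega))
    have hf0 : f 0 = 0 := by simpa using hk 0 (by omega)
    refine ⟨wmean k b, contDiffOn_wmean hb k, fun t ht => ?_⟩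
    have h1 : ∫ v in (0 : ℝ)..t, derivWithin f (Ici 0) v = f t - f 0 := by
      apply intervalIntegral.integral_eq_sub_of_hasDeriv_right_of_le ht
        (hf.continuousOn.mono Icc_subset_Ici_self)
      · intro x hx
        exact (((hf.differentiableOn (by simp)) x hx.1.le).hasDerivWithinAt).mono
          (fun y hy => hx.1.le.trans (le_of_lt hy))
      · exact (hf'.continuousOn.mono (by rw [uIcc_of_le ht]; exact Icc_subset_Ici_self)).intervalIntegrable
    rw [hf0, sub_zero] at h1
    rcases ht.eq_or_lt with rfl | ht0
    · simp [hf0]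
    rw [← h1, wmean]
    have h2 := intervalIntegral.smul_integral_comp_mul_right (a := 0) (b := 1)
      (fun v => derivWithin f (Ici 0) v) t
    rw [zero_mul, one_mul] at h2
    rw [← h2, pow_succ', mul_assoc, ← intervalIntegral.integral_const_mul, Complex.real_smul]
    congr 1
    refine intervalIntegral.integral_congr fun u hu => ?_
    rw [uIcc_of_le zero_le_one] at hu
    simp only [hfb _ (mul_nonneg hu.1 ht), Complex.real_smul]
    push_cast; ring

/-! ### Symbols -/

/-- Symbols of order `-k` on `[0,∞)`: these are the functions `a(s) = χ(1/s)` for `χ` in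
`C^∞([0,∞])` vanishing to order `k` at `0`; the function `b` is `χ(t)/t^k`. -/
def IsSymbol (k : ℕ) (a : ℝ → ℂ) : Prop :=
  ContDiffOn ℝ ∞ a (Ici 0) ∧ ∃ b : ℝ → ℂ, ContDiffOn ℝ ∞ b (Ici 0) ∧
    ∀ s, 0 < s → a s = (s⁻¹ : ℂ) ^ k * b s⁻¹

lemma SmoothExt.exists_eq_pow_mul {χ : ℝ≥0∞ → ℂ} {k : ℕ} (h : SmoothExt χ)
    (hk : VanishesToOrder χ k) : ∃ b : ℝ → ℂ, ContDiffOn ℝ ∞ b (Ici 0) ∧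
      ∀ t, 0 ≤ t → χ (ENNReal.ofReal t) = (t : ℂ) ^ k * b t :=
  ResidueReg.exists_eq_pow_mul h.1 hk

lemma SmoothExt.isSymbol {χ : ℝ≥0∞ → ℂ} {k : ℕ} (h : SmoothExt χ)
    (hk : VanishesToOrder χ k) : IsSymbol k (fun s => χ (ENNReal.ofReal s)⁻¹) := by
  obtain ⟨b, hb, hχ⟩ := h.exists_eq_pow_mul hk
  refine ⟨h.2, b, hb, fun s hs => ?_⟩
  change χ (ENNReal.ofReal s)⁻¹ = _
  rw [← ENNReal.ofReal_inv_of_pos hs, hχ _ (inv_nonneg.2 hs.le)]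
  push_cast; rfl

/-- The Euler derivative `s a'(s)` on `[0,∞)`. -/
noncomputable def euler (a : ℝ → ℂ) (s : ℝ) : ℂ := s * derivWithin a (Ici 0) s

lemma contDiffOn_euler {a : ℝ → ℂ} (ha : ContDiffOn ℝ ∞ a (Ici 0)) :
    ContDiffOn ℝ ∞ (euler a) (Ici 0) :=
  Complex.ofRealCLM.contDiff.contDiffOn.mul
    ((contDiffOn_infty_iff_derivWithin (uniqueDiffOn_Ici (0 : ℝ))).1 ha).2

namespace IsSymbol

variable {k : ℕ} {a : ℝ → ℂ}

lemma hasDerivAt (ha : IsSymbol k a) {s : ℝ} (hs : 0 < s) :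
    HasDerivAt a (derivWithin a (Ici 0) s) s :=
  ((ha.1.differentiableOn (by simp)) s hs.le).hasDerivWithinAt.hasDerivAt (Ici_mem_nhds hs)

lemma euler (ha : IsSymbol k a) : IsSymbol k (euler a) := by
  refine ⟨contDiffOn_euler ha.1, ?_⟩
  obtain ⟨b, hb, hab⟩ := ha.2
  refine ⟨fun t => -(k * b t + ResidueReg.euler b t),
    ((contDiffOn_const.mul hb).add (contDiffOn_euler hb)).neg, fun s hs => ?_⟩
  have hs' : 0 < s⁻¹ := inv_pos.2 hs
  have h1 : HasDerivAt b (derivWithin b (Ici 0) s⁻¹) s⁻¹ :=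
    ((hb.differentiableOn (by simp)) s⁻¹ hs'.le).hasDerivWithinAt.hasDerivAt (Ici_mem_nhds hs')
  have h2 : HasDerivAt (fun s : ℝ => b s⁻¹) (-(s ^ 2)⁻¹ • derivWithin b (Ici 0) s⁻¹) s :=
    h1.scomp s (hasDerivAt_inv hs.ne')
  have h3 : HasDerivAt (fun s : ℝ => ((s⁻¹ ^ k : ℝ) : ℂ))
      ((k * s⁻¹ ^ (k - 1) * -(s ^ 2)⁻¹ : ℝ) : ℂ) s := by
    exact HasDerivAt.ofReal_comp ((hasDerivAt_inv hs.ne').pow k)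
  have h4 := h3.mul h2
  have h5 : HasDerivAt a _ s := h4.congr_of_eventuallyEq (by
    filter_upwards [Ioi_mem_nhds hs] with x hx
    rw [hab x hx]; simp)
  have hsC : (s : ℂ) ≠ 0 := by exact_mod_cast hs.ne'
  unfold ResidueReg.euler
  rw [(ha.hasDerivAt hs).unique h5, Complex.real_smul]
  push_cast
  rcases k with _ | k
  · simp; field_simp
  · simp only [Nat.add_sub_cancel, inv_pow]; push_cast; field_simp; ring

/-- A symbol of order `-k` is `O((1+s)^{-k})`. -/
lemma exists_bound (ha : IsSymbol k a) :
    ∃ C : ℝ, 0 ≤ C ∧ ∀ s, 0 ≤ s → ‖a s‖ ≤ C ∧ s ^ k * ‖a s‖ ≤ C := by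
  obtain ⟨b, hb, hab⟩ := ha.2
  obtain ⟨C, hC⟩ := (isCompact_Icc (a := (0 : ℝ)) (b := 1)).exists_bound_of_continuousOn
    (ha.1.continuousOn.mono Icc_subset_Ici_self)
  obtain ⟨D, hD⟩ := (isCompact_Icc (a := (0 : ℝ)) (b := 1)).exists_bound_of_continuousOn
    (hb.continuousOn.mono Icc_subset_Ici_self)
  have hC0 : 0 ≤ C := (norm_nonneg _).trans (hC 0 (by simp))
  refine ⟨max C D, hC0.trans (le_max_left _ _), fun s hs => ?_⟩
  rcases le_or_gt s 1 with h | h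
  · have h1 := (hC s ⟨hs, h⟩).trans (le_max_left C D)
    exact ⟨h1, (mul_le_of_le_one_left (norm_nonneg _) (pow_le_one₀ hs h)).trans h1⟩
  · have hs0 : 0 < s := zero_lt_one.trans h
    have h1 := (hD s⁻¹ ⟨inv_nonneg.2 hs, inv_le_one_of_one_le₀ h.le⟩).trans (le_max_right C D)
    have h2 : ‖a s‖ = (s ^ k)⁻¹ * ‖b s⁻¹‖ := by
      rw [hab s hs0, norm_mul, norm_pow, norm_inv, Complex.norm_real, Real.norm_eq_abs,
        abs_of_pos hs0, inv_pow]
    rw [h2]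
    refine ⟨(mul_le_of_le_one_left (norm_nonneg _)
      (inv_le_one_of_one_le₀ (one_le_pow₀ h.le))).trans h1, ?_⟩
    rwa [← mul_assoc, mul_inv_cancel₀ (pow_pos hs0 k).ne', one_mul]

/-- A symbol is bounded and Lipschitz on `[0,∞)`, hence Hölder continuous for all exponents. -/
lemma exists_holder (ha : IsSymbol k a) {r : ℝ} (hr : 0 ≤ r) (hr1 : r ≤ 1) :
    ∃ C : ℝ, 0 ≤ C ∧ ∀ s s', 0 ≤ s → 0 ≤ s' → ‖a s - a s'‖ ≤ C * |s - s'| ^ r := by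
  obtain ⟨A, hA0, hA⟩ := ha.exists_bound
  obtain ⟨B, hB0, hB⟩ := ha.euler.exists_bound
  obtain ⟨D, hD⟩ := (isCompact_Icc (a := (0 : ℝ)) (b := 1)).exists_bound_of_continuousOn
    ((ha.1.continuousOn_derivWithin (uniqueDiffOn_Ici 0) (by simp)).mono Icc_subset_Ici_self)
  have hder : ∀ s ∈ Ici (0 : ℝ), ‖derivWithin a (Ici 0) s‖ ≤ max B D := by
    intro s hs
    rcases le_or_gt s 1 with h | h
    · exact (hD s ⟨hs, h⟩).trans (le_max_right _ _)
    · refine le_trans ?_ ((hB s hs).1.trans (le_max_left _ _))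
      unfold ResidueReg.euler
      rw [norm_mul, Complex.norm_real, Real.norm_eq_abs, abs_of_nonneg hs]
      exact le_mul_of_one_le_left (norm_nonneg _) h.le
  have hL : ∀ s s', 0 ≤ s → 0 ≤ s' → ‖a s - a s'‖ ≤ max B D * |s - s'| := fun s s' hs hs' =>
    (convex_Ici 0).norm_image_sub_le_of_norm_derivWithin_le (ha.1.differentiableOn (by simp))
      hder hs' hs
  refine ⟨max (2 * A) (max B D), by positivity, fun s s' hs hs' => ?_⟩
  rcases le_or_gt |s - s'| 1 with h | h
  · refine (hL s s' hs hs').trans (mul_le_mul (le_max_right _ _) ?_ (abs_nonneg _) (by positivity))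
    rcases (abs_nonneg (s - s')).eq_or_lt with h0 | h0
    · rw [← h0]; positivity
    · simpa using Real.rpow_le_rpow_of_exponent_ge h0 h hr1
  · have h1 : 1 ≤ |s - s'| ^ r := Real.one_le_rpow h.le hr
    calc ‖a s - a s'‖ ≤ ‖a s‖ + ‖a s'‖ := norm_sub_le _ _
      _ ≤ 2 * A := by linarith [(hA s hs).1, (hA s' hs').1]
      _ ≤ max (2 * A) (max B D) * 1 := by rw [mul_one]; exact le_max_left _ _
      _ ≤ _ := by gcongr

end IsSymbol

/-! ### Averages over finite subgroups of the torus -/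

section Torus

variable {ι : Type*} [Fintype ι] [DecidableEq ι]

/-- The derivative `∂u/∂ζ_j = (∂u/∂x_j - i ∂u/∂y_j) / 2`. -/
noncomputable def dhol (u : (ι → ℂ) → ℂ) (j : ι) (z : ι → ℂ) : ℂ :=
  (fderiv ℝ u z (Pi.single j 1) - Complex.I * fderiv ℝ u z (Pi.single j Complex.I)) / 2

lemma fderiv_single (u : (ι → ℂ) → ℂ) (j : ι) (z : ι → ℂ) (w : ℂ) :
    fderiv ℝ u z (Pi.single j w) = w * dhol u j z + conj w * dbar u j z := by
  have h : (Pi.single j w : ι → ℂ) = w.re • (Pi.single j 1 : ι → ℂ) +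
      w.im • (Pi.single j Complex.I : ι → ℂ) := by
    rw [← Pi.single_smul, ← Pi.single_smul, ← Pi.single_add]
    congr 1
    simp [Complex.re_add_im]
  have hw : conj w = w.re - w.im * Complex.I := by
    apply Complex.ext <;> simp
  rw [h, map_add, map_smul, map_smul, dhol, dbar, hw, Complex.real_smul, Complex.real_smul]
  linear_combination (w.im * fderiv ℝ u z (Pi.single j Complex.I)) * Complex.I_sq +
    ((fderiv ℝ u z (Pi.single j 1) - Complex.I * fderiv ℝ u z (Pi.single j Complex.I)) / 2) *
      Complex.re_add_im w

lemma contDiff_fderiv_single {u : (ι → ℂ) → ℂ} (hu : ContDiff ℝ ∞ u) (w : ι → ℂ) :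
    ContDiff ℝ ∞ (fun z => fderiv ℝ u z w) :=
  (hu.fderiv_right (m := ∞) (by simp)).clm_apply contDiff_const

lemma contDiff_dhol {u : (ι → ℂ) → ℂ} (hu : ContDiff ℝ ∞ u) (j : ι) :
    ContDiff ℝ ∞ (dhol u j) :=
  ((contDiff_fderiv_single hu _).sub (contDiff_const.mul (contDiff_fderiv_single hu _))).div_const 2

lemma contDiff_dbar {u : (ι → ℂ) → ℂ} (hu : ContDiff ℝ ∞ u) (j : ι) :
    ContDiff ℝ ∞ (dbar u j) :=
  ((contDiff_fderiv_single hu _).add (contDiff_const.mul (contDiff_fderiv_single hu _))).div_const 2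

variable (ι) in
/-- The closed polydisc of polyradius `(R, …, R)` around `0`. -/
def polydisc (R : ℝ) : Set (ι → ℂ) := {z | ∀ j, ‖z j‖ ≤ R}

/-- The bound `B` on the polydisc for all derivatives of `g` obtained by applying, for each entry
`j` of the list, either `∂/∂ζ_j` or `∂/∂ζ̄_j`. -/
def DerivBound (R B : ℝ) : List ι → ((ι → ℂ) → ℂ) → Prop
  | [], g => ∀ z ∈ polydisc ι R, ‖g z‖ ≤ B
  | j :: L, g => DerivBound R B L (dhol g j) ∧ DerivBound R B L (dbar g j)

variable {N : ℕ} [NeZero N]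

/-- The action of the group of `N`-th roots of unity on each coordinate. -/
noncomputable def rot (a : ι → ZMod N) (z : ι → ℂ) (j : ι) : ℂ := ZMod.stdAddChar (a j) * z j

lemma norm_rot (a : ι → ZMod N) (z : ι → ℂ) (j : ι) : ‖rot a z j‖ = ‖z j‖ := by
  simp [rot]

lemma rot_mem_polydisc {R : ℝ} (a : ι → ZMod N) {z : ι → ℂ} :
    rot a z ∈ polydisc ι R ↔ z ∈ polydisc ι R := by
  simp [polydisc, norm_rot]

variable (N) in
/-- The component of `g` of weight `M` for the action of the roots of unity, times the order of
the group. -/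
noncomputable def torusSum (M : ι → ℤ) (g : (ι → ℂ) → ℂ) (z : ι → ℂ) : ℂ :=
  ∑ a : ι → ZMod N, ZMod.stdAddChar (-∑ j, (M j : ZMod N) * a j) * g (rot a z)

lemma conj_stdAddChar (x : ZMod N) : conj (ZMod.stdAddChar x) = ZMod.stdAddChar (-x) :=
  (AddChar.map_neg_eq_conj _ _).symm

lemma sum_add_single (M : ι → ℤ) (a : ι → ZMod N) (j : ι) (c : ℤ) :
    ∑ i, ((M + Pi.single j c : ι → ℤ) i : ZMod N) * a i = ∑ i, (M i : ZMod N) * a i + c * a j := by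
  simp only [Pi.add_apply, Int.cast_add, add_mul, Finset.sum_add_distrib]
  congr 1
  rw [Finset.sum_eq_single j] <;> simp +contextual

/-- A component of nonzero weight in the variable `ζ_j` vanishes where `ζ_j = 0`. -/
lemma torusSum_eq_zero {M : ι → ℤ} (g : (ι → ℂ) → ℂ) {z : ι → ℂ} {j : ι} (hz : z j = 0)
    (hM : (M j : ZMod N) ≠ 0) : torusSum N M g z = 0 := by
  have h1 : torusSum N M g z = ZMod.stdAddChar (-(M j : ZMod N)) * torusSum N M g z := by
    simp only [torusSum, Finset.mul_sum]
    rw [← Equiv.sum_comp (Equiv.addRight (Pi.single j (1 : ZMod N) : ι → ZMod N))]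
    refine Finset.sum_congr rfl fun a _ => ?_
    have h2 : rot (a + Pi.single j 1) z = rot a z := by
      ext i
      by_cases hi : i = j
      · subst hi; simp [rot, hz]
      · simp [rot, hi]
    have h3 : -∑ i, (M i : ZMod N) * (a + Pi.single j 1 : ι → ZMod N) i =
        -(M j : ZMod N) + -∑ i, (M i : ZMod N) * a i := by
      simp only [Pi.add_apply, mul_add, Finset.sum_add_distrib]
      rw [neg_add_rev]
      congr 2
      rw [Finset.sum_eq_single j] <;> simp +contextual
    rw [Equiv.coe_addRight, h2, h3, AddChar.map_add_eq_mul, mul_assoc]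
  have h4 : ZMod.stdAddChar (-(M j : ZMod N)) ≠ (1 : ℂ) := by
    intro h
    rw [← AddChar.map_zero_eq_one (ZMod.stdAddChar (N := N))] at h
    exact hM (by simpa using ZMod.injective_stdAddChar h)
  have h5 : (1 - ZMod.stdAddChar (-(M j : ZMod N))) * torusSum N M g z = 0 := by
    rw [sub_mul, one_mul, ← h1, sub_self]
  exact (mul_eq_zero.1 h5).resolve_left (sub_ne_zero.2 h4.symm)

lemma hasDerivAt_torusSum {g : (ι → ℂ) → ℂ} (hg : Differentiable ℝ g) (M : ι → ℤ) (z : ι → ℂ)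
    (j : ι) (u : ℝ) :
    HasDerivAt (fun u : ℝ => torusSum N M g (Function.update z j (u * z j)))
      (z j * torusSum N (M + Pi.single j (-1)) (dhol g j) (Function.update z j (u * z j)) +
        conj (z j) * torusSum N (M + Pi.single j 1) (dbar g j) (Function.update z j (u * z j))) u := by
  have hrot : ∀ (a : ι → ZMod N) (u : ℝ), rot a (Function.update z j (u * z j)) =
      rot a (Function.update z j 0) +
        u • (Pi.single j (ZMod.stdAddChar (a j) * z j) : ι → ℂ) := by
    intro a u
    ext i
    by_cases hi : i = j
    · subst hi; simp [rot]; ring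
    · simp [rot, hi]
  have h1 : ∀ a : ι → ZMod N, HasDerivAt
      (fun u : ℝ => ZMod.stdAddChar (-∑ i, (M i : ZMod N) * a i) *
        g (rot a (Function.update z j (u * z j))))
      (ZMod.stdAddChar (-∑ i, (M i : ZMod N) * a i) *
        fderiv ℝ g (rot a (Function.update z j (u * z j)))
          (Pi.single j (ZMod.stdAddChar (a j) * z j))) u := by
    intro a
    refine HasDerivAt.const_mul _ ?_
    have h2 : HasDerivAt (fun u : ℝ => rot a (Function.update z j (u * z j)))
        (Pi.single j (ZMod.stdAddChar (a j) * z j)) u := by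
      simp only [hrot]
      simpa using ((hasDerivAt_id u).smul_const
        (Pi.single j (ZMod.stdAddChar (a j) * z j) : ι → ℂ)).const_add
        (rot a (Function.update z j 0))
    exact (hg _).hasFDerivAt.comp_hasDerivAt u h2
  have h3 := HasDerivAt.fun_sum (u := Finset.univ) fun a _ => h1 a
  refine h3.congr_deriv ?_
  simp only [torusSum, Finset.mul_sum, ← Finset.sum_add_distrib]
  refine Finset.sum_congr rfl fun a _ => ?_
  rw [fderiv_single, sum_add_single, sum_add_single, map_mul, conj_stdAddChar, neg_add, neg_add,
    AddChar.map_add_eq_mul, AddChar.map_add_eq_mul]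
  simp only [Int.cast_neg, Int.cast_one, neg_mul, one_mul, neg_neg]
  ring

/-- The component of weight `M` of a smooth function is `O(|ζ^M|)`, uniformly in terms of bounds
on derivatives whose order in each variable `ζ_j` is `M_j`. The induction on the list of
derivatives integrates from `ζ_j = 0`, where the component vanishes. -/
lemma norm_torusSum_le {R B : ℝ} (hB : 0 ≤ B) (L : List ι) :
    ∀ {g : (ι → ℂ) → ℂ} {M : ι → ℤ}, ContDiff ℝ ∞ g →
    (∀ j, (L.count j : ℤ) ≤ M j ∧ M j + L.count j ≤ N) → DerivBound R B L g →
    ∀ z ∈ polydisc ι R, ‖torusSum N M g z‖ ≤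
      Fintype.card (ι → ZMod N) * 2 ^ L.length * (L.map fun j => ‖z j‖).prod * B := by
  induction L with
  | nil =>
    intro g M hg hM hb z hz
    refine (norm_sum_le _ _).trans ((Finset.sum_le_card_nsmul _ _ B fun a _ => ?_).trans ?_)
    · rw [norm_mul, AddChar.norm_apply, one_mul]
      exact hb _ ((rot_mem_polydisc a).2 hz)
    · simp [nsmul_eq_mul]
  | cons j L ih =>
    intro g M hg hM hb z hz
    have hMj := hM j
    rw [List.count_cons_self] at hMj
    push_cast at hMj
    have hMj0 : (M j : ZMod N) ≠ 0 := by
      rw [Ne, ZMod.intCast_zmod_eq_zero_iff_dvd]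
      intro h
      have := Int.le_of_dvd (by omega) h
      omega
    set K : ℝ := Fintype.card (ι → ZMod N) * 2 ^ L.length * (L.map fun j => ‖z j‖).prod * B with hK
    have hsub : ∀ u ∈ Ico (0 : ℝ) 1, Function.update z j (u * z j) ∈ polydisc ι R ∧
        (L.map fun i => ‖Function.update z j (u * z j) i‖).prod ≤ (L.map fun i => ‖z i‖).prod := by
      intro u hu
      have h1 : ∀ i, ‖Function.update z j (u * z j) i‖ ≤ ‖z i‖ := by
        intro i
        by_cases hi : i = j
        · subst hi
          rw [Function.update_self, norm_mul, Complex.norm_real, Real.norm_eq_abs,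
            abs_of_nonneg hu.1]
          exact mul_le_of_le_one_left (norm_nonneg _) hu.2.le
        · rw [Function.update_of_ne hi]
      exact ⟨fun i => (h1 i).trans (hz i), List.prod_map_le_prod_map₀ _ _
        (fun i _ => norm_nonneg _) fun i _ => h1 i⟩
    have hder : ∀ u ∈ Ico (0 : ℝ) 1,
        ‖z j * torusSum N (M + Pi.single j (-1)) (dhol g j) (Function.update z j (u * z j)) +
          conj (z j) * torusSum N (M + Pi.single j 1) (dbar g j) (Function.update z j (u * z j))‖
          ≤ 2 * ‖z j‖ * K := by
      intro u hu
      obtain ⟨hu1, hu2⟩ := hsub u hu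
      have hcount : ∀ c : ℤ, |c| ≤ 1 → ∀ i, (L.count i : ℤ) ≤ (M + Pi.single j c : ι → ℤ) i ∧
          (M + Pi.single j c : ι → ℤ) i + L.count i ≤ N := by
        intro c hc i
        rw [abs_le] at hc
        by_cases hi : i = j
        · subst hi
          simp only [Pi.add_apply, Pi.single_eq_same]
          omega
        · have := hM i
          rw [List.count_cons_of_ne (Ne.symm hi)] at this
          simpa [hi] using this
      have hle : (Fintype.card (ι → ZMod N) : ℝ) * 2 ^ L.length *
          (L.map fun i => ‖Function.update z j (u * z j) i‖).prod * B ≤ K := by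
        rw [hK]; gcongr
      have e1 := (ih (contDiff_dhol hg j) (hcount (-1) (by simp)) hb.1 _ hu1).trans hle
      have e2 := (ih (contDiff_dbar hg j) (hcount 1 (by simp)) hb.2 _ hu1).trans hle
      calc _ ≤ ‖z j‖ * K + ‖z j‖ * K := by
            refine (norm_add_le _ _).trans ?_
            rw [norm_mul, norm_mul, RCLike.norm_conj]
            gcongr
        _ = _ := by ring
    have hmv := norm_image_sub_le_of_norm_deriv_le_segment_01'
      (fun u _ => (hasDerivAt_torusSum (N := N) (hg.differentiable (by simp)) M z j u).hasDerivWithinAt)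
      hder
    have h0 : torusSum N M g (Function.update z j ((0 : ℝ) * z j)) = 0 :=
      torusSum_eq_zero g (by simp) hMj0
    have h1 : Function.update z j ((1 : ℝ) * z j) = z := by simp
    rw [h0, h1, sub_zero] at hmv
    refine hmv.trans (le_of_eq ?_)
    rw [hK, List.map_cons, List.prod_cons, List.length_cons]
    ring

end Torus

/-! ### Principal values through torus averages -/

section TorusMean

variable {ι : Type*} [Fintype ι] [DecidableEq ι] {N : ℕ} [NeZero N]

variable (N) in
/-- The average of `g / ζ^γ` over the orbit of a point under the `N`-th roots of unity. It is
`0` where `ζ^γ = 0`, a null set. -/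
noncomputable def torusMean (γ : ι → ℕ) (g : (ι → ℂ) → ℂ) (z : ι → ℂ) : ℂ :=
  (Fintype.card (ι → ZMod N) : ℂ)⁻¹ * ∑ a : ι → ZMod N, (monom γ (rot a z))⁻¹ * g (rot a z)

lemma torusMean_sub (γ : ι → ℕ) (g h : (ι → ℂ) → ℂ) (z : ι → ℂ) :
    torusMean N γ (fun z => g z - h z) z = torusMean N γ g z - torusMean N γ h z := by
  simp only [torusMean, mul_sub, Finset.sum_sub_distrib]

lemma monom_rot (γ : ι → ℕ) (a : ι → ZMod N) (z : ι → ℂ) :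
    monom γ (rot a z) = ZMod.stdAddChar (∑ j, ((γ j : ℤ) : ZMod N) * a j) * monom γ z := by
  simp only [monom, rot, mul_pow, Finset.prod_mul_distrib]
  congr 1
  have h := map_prod (AddChar.toMonoidHom (ZMod.stdAddChar (N := N)))
    (fun j => Multiplicative.ofAdd (((γ j : ℤ) : ZMod N) * a j)) Finset.univ
  rw [← ofAdd_sum] at h
  simp only [AddChar.toMonoidHom_apply, toAdd_ofAdd] at h
  rw [h]
  refine Finset.prod_congr rfl fun j _ => ?_
  rw [← AddChar.map_nsmul_eq_pow, nsmul_eq_mul]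
  simp

lemma norm_monom_rot (γ : ι → ℕ) (a : ι → ZMod N) (z : ι → ℂ) :
    ‖monom γ (rot a z)‖ = ‖monom γ z‖ := by
  rw [monom_rot, norm_mul, AddChar.norm_apply, one_mul]

lemma torusMean_eq (γ : ι → ℕ) (g : (ι → ℂ) → ℂ) (z : ι → ℂ) :
    torusMean N γ g z = (Fintype.card (ι → ZMod N) : ℂ)⁻¹ * (monom γ z)⁻¹ *
      torusSum N (fun j => (γ j : ℤ)) g z := by
  rw [torusMean, torusSum, mul_assoc, Finset.mul_sum (a := (monom γ z)⁻¹)]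
  congr 1
  refine Finset.sum_congr rfl fun a _ => ?_
  rw [monom_rot, mul_inv, AddChar.map_neg_eq_inv]
  ring

lemma exists_list_count (γ : ι → ℕ) : ∃ L : List ι, ∀ j, L.count j = γ j := by
  refine ⟨(∑ j, γ j • ({j} : Multiset ι)).toList, fun j => ?_⟩
  rw [← Multiset.coe_count, Multiset.coe_toList, Multiset.count_sum']
  simp [Multiset.count_nsmul, Multiset.count_singleton]

lemma prod_map_list {γ : ι → ℕ} {L : List ι}
    (hL : ∀ j, L.count j = γ j) (z : ι → ℂ) : (L.map fun j => ‖z j‖).prod = ‖monom γ z‖ := by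
  rw [Finset.prod_list_map_count, monom, norm_prod]
  simp only [norm_pow, hL]
  refine Finset.prod_subset (Finset.subset_univ _) fun j _ hj => ?_
  rw [← hL, List.count_eq_zero_of_not_mem (by simpa using hj), pow_zero]

/-- The average of `g / ζ^γ` over the torus is bounded in terms of derivatives of `g`. -/
lemma norm_torusMean_le {R B : ℝ} (hB : 0 ≤ B) {γ : ι → ℕ} (hN : ∀ j, 2 * γ j ≤ N)
    {L : List ι} (hL : ∀ j, L.count j = γ j) {g : (ι → ℂ) → ℂ} (hg : ContDiff ℝ ∞ g)
    (hb : DerivBound R B L g) {z : ι → ℂ} (hz : z ∈ polydisc ι R) :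
    ‖torusMean N γ g z‖ ≤ 2 ^ L.length * B := by
  have h := norm_torusSum_le (N := N) hB L (M := fun j => (γ j : ℤ)) hg
    (fun j => by rw [hL]; have := hN j; constructor <;> omega) hb z hz
  rw [prod_map_list hL] at h
  rw [torusMean_eq, norm_mul, norm_mul, norm_inv, norm_inv, Complex.norm_natCast]
  have hc : (0 : ℝ) < Fintype.card (ι → ZMod N) := by exact_mod_cast Fintype.card_pos
  rcases (norm_nonneg (monom γ z)).eq_or_lt with h0 | h0
  · rw [← h0]; simp only [inv_zero, mul_zero, zero_mul]; positivity
  · calc _ ≤ (Fintype.card (ι → ZMod N) : ℝ)⁻¹ * ‖monom γ z‖⁻¹ *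
          (Fintype.card (ι → ZMod N) * 2 ^ L.length * ‖monom γ z‖ * B) := by gcongr
      _ = _ := by field_simp

lemma polydisc_eq_pi (R : ℝ) :
    polydisc ι R = Set.univ.pi fun _ => Metric.closedBall (0 : ℂ) R := by
  ext z; simp [polydisc]

lemma isCompact_polydisc (R : ℝ) : IsCompact (polydisc ι R) := by
  rw [polydisc_eq_pi]
  exact isCompact_univ_pi fun _ => isCompact_closedBall _ _

lemma measurableSet_polydisc (R : ℝ) : MeasurableSet (polydisc ι R) :=
  (isCompact_polydisc R).isClosed.measurableSet

lemma continuous_monom (γ : ι → ℕ) : Continuous (monom γ) := by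
  unfold monom; fun_prop

lemma continuous_rot (a : ι → ZMod N) : Continuous (rot a : (ι → ℂ) → ι → ℂ) := by
  unfold rot; fun_prop

lemma measurable_torusMean (γ : ι → ℕ) {g : (ι → ℂ) → ℂ} (hg : Measurable g) :
    Measurable (torusMean N γ g) := by
  unfold torusMean
  refine Measurable.const_mul (Finset.measurable_sum _ fun a _ => ?_) _
  exact ((continuous_monom γ).comp (continuous_rot a)).measurable.inv.mul
    (hg.comp (continuous_rot a).measurable)

lemma ae_monom_ne_zero (γ : ι → ℕ) : ∀ᵐ z : ι → ℂ, monom γ z ≠ 0 := by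
  have h : ∀ j : ι, ∀ᵐ z : ι → ℂ, z j ≠ 0 := fun j => Measure.ae_eval_ne _ j 0
  filter_upwards [ae_all_iff.2 h] with z hz
  exact Finset.prod_ne_zero_iff.2 fun j _ => pow_ne_zero _ (hz j)

/-- The rotations by roots of unity as measurable equivalences. -/
noncomputable def rotEquiv (a : ι → ZMod N) : (ι → ℂ) ≃ᵐ (ι → ℂ) :=
  MeasurableEquiv.piCongrRight fun j =>
    (rotation (ZMod.toCircle (a j))).toHomeomorph.toMeasurableEquiv

lemma coe_rotEquiv (a : ι → ZMod N) : ⇑(rotEquiv a) = rot a := by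
  ext z j
  exact rotation_apply _ _

lemma measurePreserving_rot (a : ι → ZMod N) :
    MeasurePreserving (rot a : (ι → ℂ) → ι → ℂ) :=
  volume_preserving_pi fun j => by
    exact (rotation (ZMod.toCircle (a j))).measurePreserving

lemma setIntegral_rot (R : ℝ) (a : ι → ZMod N) (F : (ι → ℂ) → ℂ) :
    ∫ z in polydisc ι R, F (rot a z) = ∫ z in polydisc ι R, F z := by
  have h := (measurePreserving_rot a).setIntegral_preimage_emb
    (by rw [← coe_rotEquiv]; exact (rotEquiv a).measurableEmbedding) F (polydisc ι R)
  rwa [show rot a ⁻¹' polydisc ι R = polydisc ι R from Set.ext fun z => rot_mem_polydisc a] at h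

lemma integrableOn_rot {R : ℝ} (a : ι → ZMod N) {F : (ι → ℂ) → ℂ}
    (hF : IntegrableOn F (polydisc ι R)) : IntegrableOn (fun z => F (rot a z)) (polydisc ι R) := by
  have h := (measurePreserving_rot a).integrableOn_comp_preimage
    (by rw [← coe_rotEquiv]; exact (rotEquiv a).measurableEmbedding) (f := F) (s := polydisc ι R)
  rw [show rot a ⁻¹' polydisc ι R = polydisc ι R from Set.ext fun z => rot_mem_polydisc a] at h
  exact h.2 hF

variable (N) in
/-- The integral over a polydisc does not change under averaging over the torus. -/
lemma setIntegral_eq_average {R : ℝ} {F : (ι → ℂ) → ℂ} (hF : IntegrableOn F (polydisc ι R)) :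
    ∫ z in polydisc ι R, F z = ∫ z in polydisc ι R,
      (Fintype.card (ι → ZMod N) : ℂ)⁻¹ * ∑ a : ι → ZMod N, F (rot a z) := by
  rw [integral_const_mul, integral_finsetSum _ fun a _ => integrableOn_rot a hF]
  simp only [setIntegral_rot, Finset.sum_const, Finset.card_univ, nsmul_eq_mul]
  have hc : (Fintype.card (ι → ZMod N) : ℂ) ≠ 0 := by exact_mod_cast Fintype.card_ne_zero
  rw [inv_mul_cancel_left₀ hc]

/-- The principal value of `ψ / ζ^γ` is the integral of the torus averages, if these are bounded:
the domains `|ζ^γ|² > δ` are invariant under rotations, so that the limit is taken under the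
integral of the averages. -/
lemma hasPrincipalValue_of_torusMean {γ : ι → ℕ} {ψ : (ι → ℂ) → ℂ} {R C D : ℝ}
    (hψm : Measurable ψ) (hψ : ∀ z, ‖ψ z‖ ≤ D) (hsupp : ∀ z ∉ polydisc ι R, ψ z = 0)
    (hC : ∀ z ∈ polydisc ι R, ‖torusMean N γ ψ z‖ ≤ C) :
    HasPrincipalValue γ ψ (∫ z in polydisc ι R, torusMean N γ ψ z) := by
  have hms : ∀ δ : ℝ, MeasurableSet {z : ι → ℂ | δ < ‖monom γ z‖ ^ 2} := fun δ =>
    (isOpen_lt continuous_const ((continuous_monom γ).norm.pow 2)).measurableSet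
  have hfin : volume (polydisc ι R) ≠ ⊤ := (isCompact_polydisc R).measure_lt_top.ne
  have hcut : ∀ δ ∈ Ioi (0 : ℝ), ∫ z in {z : ι → ℂ | δ < ‖monom γ z‖ ^ 2}, ψ z / monom γ z =
      ∫ z in polydisc ι R,
        {z : ι → ℂ | δ < ‖monom γ z‖ ^ 2}.indicator (torusMean N γ ψ) z := by
    intro δ hδ
    have hδ : 0 < δ := hδ
    set S := {z : ι → ℂ | δ < ‖monom γ z‖ ^ 2} with hS
    have hD : 0 ≤ D := (norm_nonneg _).trans (hψ 0)
    have hint : IntegrableOn (S.indicator fun z => ψ z / monom γ z) (polydisc ι R) := by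
      refine Integrable.mono' (g := fun _ => D / Real.sqrt δ) (integrableOn_const hfin) ?_ ?_
      · exact ((hψm.div (continuous_monom γ).measurable).indicator (hms δ)).aestronglyMeasurable
      · refine .of_forall fun z => ?_
        by_cases hz : z ∈ S
        · rw [indicator_of_mem hz, norm_div]
          exact div_le_div₀ hD (hψ z) (Real.sqrt_pos.2 hδ) (Real.sqrt_le_iff.2
            ⟨norm_nonneg _, le_of_lt hz⟩)
        · rw [indicator_of_notMem hz, norm_zero]; positivity
    have h1 : ∫ z in S, ψ z / monom γ z =
        ∫ z in polydisc ι R, S.indicator (fun z => ψ z / monom γ z) z := by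
      rw [← integral_indicator (hms δ), setIntegral_eq_integral_of_forall_compl_eq_zero]
      intro z hz
      by_cases hzS : z ∈ S
      · rw [indicator_of_mem hzS, hsupp z hz, zero_div]
      · rw [indicator_of_notMem hzS]
    rw [h1, setIntegral_eq_average N hint]
    refine integral_congr_ae (.of_forall fun z => ?_)
    have hrot : ∀ a : ι → ZMod N, rot a z ∈ S ↔ z ∈ S := fun a => by
      simp only [hS, mem_ofPred_eq, norm_monom_rot]
    by_cases hz : z ∈ S
    · simp only [indicator_of_mem ((hrot _).2 hz), indicator_of_mem hz, torusMean]
      congr 1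
      exact Finset.sum_congr rfl fun a _ => by rw [div_eq_mul_inv, mul_comm]
    · simp only [indicator_of_notMem (mt (hrot _).1 hz), indicator_of_notMem hz,
        Finset.sum_const_zero, mul_zero]
  refine Tendsto.congr' (eventually_nhdsWithin_of_forall fun δ hδ => (hcut δ hδ).symm) ?_
  refine tendsto_integral_filter_of_dominated_convergence (fun _ => C) ?_ ?_
    (integrableOn_const hfin) ?_
  · exact .of_forall fun δ =>
      ((measurable_torusMean γ hψm).indicator (hms δ)).aestronglyMeasurable
  · refine .of_forall fun δ => (ae_restrict_iff' (measurableSet_polydisc R)).2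
      (.of_forall fun z hz => (norm_indicator_le_norm_self _ _).trans (hC z hz))
  · refine ae_restrict_of_ae ?_
    filter_upwards [ae_monom_ne_zero γ] with z hz
    refine tendsto_const_nhds.congr' ?_
    have h0 : 0 < ‖monom γ z‖ ^ 2 := by positivity
    filter_upwards [nhdsWithin_le_nhds (Iio_mem_nhds h0)] with δ hδ
    rw [indicator_of_mem (show z ∈ {z : ι → ℂ | δ < ‖monom γ z‖ ^ 2} from hδ)]

end TorusMean

/-! ### Amplitudes -/

section Amplitude

variable {ι : Type*} [Fintype ι] [DecidableEq ι] {Φ Ψ : (ι → ℂ) → ℝ}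

/-- The composition `z ↦ a(s/Φ(z))` with a symbol is smooth, for `s ≥ 0`. -/
lemma contDiff_symbol_comp {k : ℕ} {a : ℝ → ℂ} (ha : IsSymbol k a) (hΦ : ContDiff ℝ ∞ Φ)
    (hΦ0 : ∀ z, 0 < Φ z) {s : ℝ} (hs : 0 ≤ s) : ContDiff ℝ ∞ (fun z => a (s / Φ z)) :=
  ha.1.comp_contDiff (contDiff_const.div hΦ fun z => (hΦ0 z).ne')
    fun z => div_nonneg hs (hΦ0 z).le

/-- Derivatives of `a(s/Φ)` are again of this form, up to the smooth factor `-dΦ/Φ`, with the Euler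
derivative in place of `a`; this is why bounds that are uniform in `s` persist under derivatives. -/
lemma fderiv_symbol_comp {k : ℕ} {a : ℝ → ℂ} (ha : IsSymbol k a) {z : ι → ℂ}
    (hΦ : DifferentiableAt ℝ Φ z) (hΦ0 : 0 < Φ z) {s : ℝ} (hs : 0 ≤ s) (w : ι → ℂ) :
    fderiv ℝ (fun z => a (s / Φ z)) z w =
      -((fderiv ℝ Φ z w / Φ z : ℝ) : ℂ) * euler a (s / Φ z) := by
  rcases hs.eq_or_lt with rfl | hs
  · simp [euler]
  have hd : HasFDerivAt Φ (fderiv ℝ Φ z) z := hΦ.hasFDerivAt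
  have h1 : HasFDerivAt (fun z => s / Φ z) (-(s / Φ z ^ 2) • fderiv ℝ Φ z) z := by
    have := (hasDerivAt_inv hΦ0.ne').comp_hasFDerivAt z hd
    have := this.const_mul s
    simp only [div_eq_mul_inv]
    refine HasFDerivAt.congr_fderiv this ?_
    rw [smul_smul]; ring_nf
  have h2 := (ha.hasDerivAt (div_pos hs hΦ0)).hasFDerivAt.comp z h1
  rw [show (fun z => a (s / Φ z)) = a ∘ fun z => s / Φ z from rfl, h2.fderiv]
  have h0 : (Φ z : ℂ) ≠ 0 := by exact_mod_cast hΦ0.ne'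
  simp only [euler, ContinuousLinearMap.comp_apply, smul_apply,
    ContinuousLinearMap.toSpanSingleton_apply, smul_eq_mul, Complex.real_smul]
  push_cast
  field_simp

/-- The amplitude `c(z) a₁(s₁/Φ(z)) a₂(s₂/Ψ(z))`. -/
noncomputable def ampl (Φ Ψ : (ι → ℂ) → ℝ) (a₁ a₂ : ℝ → ℂ) (c : (ι → ℂ) → ℂ) (s : ℝ × ℝ)
    (z : ι → ℂ) : ℂ := c z * (a₁ (s.1 / Φ z) * a₂ (s.2 / Ψ z))

/-- Finite sums of the functions `c(z) a₁(s₁/Φ(z)) a₂(s₂/Ψ(z))` with symbols `a₁, a₂` and smooth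
`c`. This class is closed under derivatives in `z`. -/
inductive IsAmplitude (Φ Ψ : (ι → ℂ) → ℝ) (k l : ℕ) : (ℝ × ℝ → (ι → ℂ) → ℂ) → Prop
  | ampl {a₁ a₂ : ℝ → ℂ} {c : (ι → ℂ) → ℂ} (h₁ : IsSymbol k a₁) (h₂ : IsSymbol l a₂)
      (hc : ContDiff ℝ ∞ c) : IsAmplitude Φ Ψ k l (ampl Φ Ψ a₁ a₂ c)
  | add {G H : ℝ × ℝ → (ι → ℂ) → ℂ} (hG : IsAmplitude Φ Ψ k l G) (hH : IsAmplitude Φ Ψ k l H) :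
      IsAmplitude Φ Ψ k l (fun s z => G s z + H s z)

namespace IsAmplitude

variable {k l : ℕ} {G : ℝ × ℝ → (ι → ℂ) → ℂ}

lemma const_mul (hG : IsAmplitude Φ Ψ k l G) (w : ℂ) :
    IsAmplitude Φ Ψ k l (fun s z => w * G s z) := by
  induction hG with
  | @ampl a₁ a₂ c h₁ h₂ hc =>
    have e : (fun s z => w * ResidueReg.ampl Φ Ψ a₁ a₂ c s z) =
        ResidueReg.ampl Φ Ψ a₁ a₂ (fun z => w * c z) := by
      ext s z; simp only [ResidueReg.ampl]; ring
    rw [e]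
    exact .ampl h₁ h₂ (contDiff_const.mul hc)
  | add _ _ ihG ihH => simpa only [mul_add] using ihG.add ihH

lemma contDiff (hΦ : ContDiff ℝ ∞ Φ) (hΨ : ContDiff ℝ ∞ Ψ) (hΦ0 : ∀ z, 0 < Φ z)
    (hΨ0 : ∀ z, 0 < Ψ z) (hG : IsAmplitude Φ Ψ k l G) {s : ℝ × ℝ} (hs : 0 ≤ s) :
    ContDiff ℝ ∞ (G s) := by
  induction hG with
  | ampl h₁ h₂ hc =>
    exact hc.mul ((contDiff_symbol_comp h₁ hΦ hΦ0 hs.1).mul (contDiff_symbol_comp h₂ hΨ hΨ0 hs.2))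
  | add _ _ ihG ihH => exact ihG.add ihH

lemma exists_fderiv (hΦ : ContDiff ℝ ∞ Φ) (hΨ : ContDiff ℝ ∞ Ψ) (hΦ0 : ∀ z, 0 < Φ z)
    (hΨ0 : ∀ z, 0 < Ψ z) (hG : IsAmplitude Φ Ψ k l G) (w : ι → ℂ) :
    ∃ G', IsAmplitude Φ Ψ k l G' ∧ ∀ s : ℝ × ℝ, 0 ≤ s → ∀ z, fderiv ℝ (G s) z w = G' s z := by
  induction hG with
  | @ampl a₁ a₂ c h₁ h₂ hc =>
    have hlog : ∀ {Θ : (ι → ℂ) → ℝ}, ContDiff ℝ ∞ Θ → (∀ z, 0 < Θ z) →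
        ContDiff ℝ ∞ (fun z => -((fderiv ℝ Θ z w / Θ z : ℝ) : ℂ)) := fun hΘ hΘ0 =>
      (Complex.ofRealCLM.contDiff.comp (((hΘ.fderiv_right (m := ∞) (by simp)).clm_apply
        contDiff_const).div hΘ fun z => (hΘ0 z).ne')).neg
    refine ⟨_, ((IsAmplitude.ampl h₁ h₂ (contDiff_fderiv_single hc w)).add
      (IsAmplitude.ampl h₁.euler h₂ (hc.mul (hlog hΦ hΦ0)))).add
      (IsAmplitude.ampl h₁ h₂.euler (hc.mul (hlog hΨ hΨ0))), fun s hs z => ?_⟩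
    have d0 := hc.differentiable (by simp) z
    have d1 := (contDiff_symbol_comp h₁ hΦ hΦ0 hs.1).differentiable (by simp) z
    have d2 := (contDiff_symbol_comp h₂ hΨ hΨ0 hs.2).differentiable (by simp) z
    unfold ResidueReg.ampl
    rw [fderiv_fun_mul d0 (d1.fun_mul d2), fderiv_fun_mul d1 d2]
    simp only [add_apply, smul_apply, smul_eq_mul,
      fderiv_symbol_comp h₁ (hΦ.differentiable (by simp) z) (hΦ0 z) hs.1,
      fderiv_symbol_comp h₂ (hΨ.differentiable (by simp) z) (hΨ0 z) hs.2]
    ring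
  | @add G H hG hH ihG ihH =>
    obtain ⟨G', hG', hGd⟩ := ihG
    obtain ⟨H', hH', hHd⟩ := ihH
    refine ⟨_, hG'.add hH', fun s hs z => ?_⟩
    rw [fderiv_fun_add ((hG.contDiff hΦ hΨ hΦ0 hΨ0 hs).differentiable (by simp) z)
      ((hH.contDiff hΦ hΨ hΦ0 hΨ0 hs).differentiable (by simp) z),
      add_apply, hGd s hs, hHd s hs]

lemma exists_dhol_dbar (hΦ : ContDiff ℝ ∞ Φ) (hΨ : ContDiff ℝ ∞ Ψ) (hΦ0 : ∀ z, 0 < Φ z)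
    (hΨ0 : ∀ z, 0 < Ψ z) (hG : IsAmplitude Φ Ψ k l G) (j : ι) :
    (∃ G', IsAmplitude Φ Ψ k l G' ∧ ∀ s : ℝ × ℝ, 0 ≤ s → dhol (G s) j = G' s) ∧
    ∃ G', IsAmplitude Φ Ψ k l G' ∧ ∀ s : ℝ × ℝ, 0 ≤ s → dbar (G s) j = G' s := by
  obtain ⟨A, hA, hAd⟩ := hG.exists_fderiv hΦ hΨ hΦ0 hΨ0 (Pi.single j 1)
  obtain ⟨B, hB, hBd⟩ := hG.exists_fderiv hΦ hΨ hΦ0 hΨ0 (Pi.single j Complex.I)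
  refine ⟨⟨_, (hA.const_mul (1 / 2)).add (hB.const_mul (-Complex.I / 2)), fun s hs => ?_⟩,
    ⟨_, (hA.const_mul (1 / 2)).add (hB.const_mul (Complex.I / 2)), fun s hs => ?_⟩⟩
  · ext z; rw [dhol, hAd s hs, hBd s hs]; ring
  · ext z; rw [dbar, hAd s hs, hBd s hs]; ring

/-- Amplitudes are bounded and Hölder continuous in `s`, uniformly for `z` in a polydisc. -/
lemma exists_bound (hΦ : ContDiff ℝ ∞ Φ) (hΨ : ContDiff ℝ ∞ Ψ) (hΦ0 : ∀ z, 0 < Φ z)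
    (hΨ0 : ∀ z, 0 < Ψ z) (hG : IsAmplitude Φ Ψ k l G) (R : ℝ) {r : ℝ} (hr : 0 ≤ r) (hr1 : r ≤ 1) :
    ∃ C : ℝ, 0 ≤ C ∧ ∀ z ∈ polydisc ι R, ∀ s s' : ℝ × ℝ, 0 ≤ s → 0 ≤ s' → ‖G s z‖ ≤ C ∧
      ‖G s z - G s' z‖ ≤ C * (|s.1 - s'.1| ^ r + |s.2 - s'.2| ^ r) := by
  induction hG with
  | @ampl a₁ a₂ c h₁ h₂ hc =>
    have hinv : ∀ {Θ : (ι → ℂ) → ℝ}, ContDiff ℝ ∞ Θ → (∀ z, 0 < Θ z) →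
        ∃ E, 0 ≤ E ∧ ∀ z ∈ polydisc ι R, ((Θ z)⁻¹) ^ r ≤ E := by
      intro Θ hΘ hΘ0
      obtain ⟨E, hE⟩ := (isCompact_polydisc (ι := ι) R).exists_bound_of_continuousOn
        (f := fun z => ((Θ z)⁻¹) ^ r) ((hΘ.continuous.inv₀ fun z => (hΘ0 z).ne').rpow_const
          fun z => Or.inr hr).continuousOn
      exact ⟨max E 0, le_max_right _ _, fun z hz =>
        (le_abs_self _).trans ((hE z hz).trans (le_max_left _ _))⟩
    have hhol : ∀ {Θ : (ι → ℂ) → ℝ} {a : ℝ → ℂ} {m : ℕ}, ContDiff ℝ ∞ Θ → (∀ z, 0 < Θ z) →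
        IsSymbol m a → ∃ E, 0 ≤ E ∧ ∀ z ∈ polydisc ι R, ∀ s s' : ℝ, 0 ≤ s → 0 ≤ s' →
          ‖a (s / Θ z)‖ ≤ E ∧ ‖a (s / Θ z) - a (s' / Θ z)‖ ≤ E * |s - s'| ^ r := by
      intro Θ a m hΘ hΘ0 ha
      obtain ⟨E, hE0, hE⟩ := hinv hΘ hΘ0
      obtain ⟨A, hA0, hA⟩ := ha.exists_bound
      obtain ⟨B, hB0, hB⟩ := ha.exists_holder hr hr1
      refine ⟨max A (B * E), hA0.trans (le_max_left _ _), fun z hz s s' hs hs' => ?_⟩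
      have p1 : 0 ≤ s / Θ z := div_nonneg hs (hΘ0 z).le
      have p2 : 0 ≤ s' / Θ z := div_nonneg hs' (hΘ0 z).le
      refine ⟨(hA _ p1).1.trans (le_max_left _ _), (hB _ _ p1 p2).trans ?_⟩
      rw [← sub_div, abs_div, abs_of_pos (hΘ0 z), div_eq_mul_inv,
        Real.mul_rpow (abs_nonneg _) (inv_nonneg.2 (hΘ0 z).le)]
      calc B * (|s - s'| ^ r * (Θ z)⁻¹ ^ r) ≤ B * (|s - s'| ^ r * E) := by
            gcongr; exact hE z hz
        _ = B * E * |s - s'| ^ r := by ring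
        _ ≤ _ := by gcongr; exact le_max_right _ _
    obtain ⟨A, hA0, hA⟩ := hhol hΦ hΦ0 h₁
    obtain ⟨B, hB0, hB⟩ := hhol hΨ hΨ0 h₂
    obtain ⟨D, hD⟩ := (isCompact_polydisc (ι := ι) R).exists_bound_of_continuousOn
      hc.continuous.continuousOn
    have hD' : ∀ z ∈ polydisc ι R, ‖c z‖ ≤ max D 0 := fun z hz => (hD z hz).trans (le_max_left _ _)
    have hD0 : 0 ≤ max D 0 := le_max_right _ _
    refine ⟨max D 0 * (A * B), by positivity, fun z hz s s' hs hs' => ⟨?_, ?_⟩⟩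
    · rw [ResidueReg.ampl, norm_mul, norm_mul]
      gcongr
      · exact hD' z hz
      · exact (hA z hz _ _ hs.1 hs'.1).1
      · exact (hB z hz _ _ hs.2 hs'.2).1
    · have e : ResidueReg.ampl Φ Ψ a₁ a₂ c s z - ResidueReg.ampl Φ Ψ a₁ a₂ c s' z =
          c z * ((a₁ (s.1 / Φ z) - a₁ (s'.1 / Φ z)) * a₂ (s.2 / Ψ z) +
            a₁ (s'.1 / Φ z) * (a₂ (s.2 / Ψ z) - a₂ (s'.2 / Ψ z))) := by
        unfold ResidueReg.ampl; ring
      obtain ⟨A1, A2⟩ := hA z hz _ _ hs.1 hs'.1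
      obtain ⟨A3, -⟩ := hA z hz _ _ hs'.1 hs.1
      obtain ⟨B1, B2⟩ := hB z hz _ _ hs.2 hs'.2
      rw [e, norm_mul]
      calc _ ≤ max D 0 * (A * |s.1 - s'.1| ^ r * B + A * (B * |s.2 - s'.2| ^ r)) := by
            refine mul_le_mul (hD' z hz) ((norm_add_le _ _).trans ?_) (norm_nonneg _) hD0
            rw [norm_mul, norm_mul]
            gcongr
        _ = _ := by ring
  | add _ _ ihG ihH =>
    obtain ⟨A, hA0, hA⟩ := ihG
    obtain ⟨B, hB0, hB⟩ := ihH
    refine ⟨A + B, by positivity, fun z hz s s' hs hs' => ⟨?_, ?_⟩⟩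
    · exact (norm_add_le _ _).trans (add_le_add (hA z hz s s' hs hs').1 (hB z hz s s' hs hs').1)
    · rw [add_sub_add_comm, add_mul]
      exact (norm_add_le _ _).trans (add_le_add (hA z hz s s' hs hs').2 (hB z hz s s' hs hs').2)

end IsAmplitude

lemma DerivBound.mono {R B B' : ℝ} (hBB : B ≤ B') (L : List ι) :
    ∀ {g : (ι → ℂ) → ℂ}, DerivBound R B L g → DerivBound R B' L g := by
  induction L with
  | nil => exact fun h z hz => (h z hz).trans hBB
  | cons j L ih => exact fun h => ⟨ih h.1, ih h.2⟩

lemma dhol_sub {u v : (ι → ℂ) → ℂ} (hu : ContDiff ℝ ∞ u) (hv : ContDiff ℝ ∞ v) (j : ι) :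
    dhol (fun z => u z - v z) j = fun z => dhol u j z - dhol v j z := by
  ext z
  simp only [dhol, fderiv_fun_sub (hu.differentiable (by simp) z) (hv.differentiable (by simp) z),
    sub_apply]
  ring

lemma dbar_sub {u v : (ι → ℂ) → ℂ} (hu : ContDiff ℝ ∞ u) (hv : ContDiff ℝ ∞ v) (j : ι) :
    dbar (fun z => u z - v z) j = fun z => dbar u j z - dbar v j z := by
  ext z
  simp only [dbar, fderiv_fun_sub (hu.differentiable (by simp) z) (hv.differentiable (by simp) z),
    sub_apply]
  ring

lemma IsAmplitude.exists_derivBound {k l : ℕ} (hΦ : ContDiff ℝ ∞ Φ) (hΨ : ContDiff ℝ ∞ Ψ)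
    (hΦ0 : ∀ z, 0 < Φ z) (hΨ0 : ∀ z, 0 < Ψ z) (R : ℝ) {r : ℝ} (hr : 0 ≤ r) (hr1 : r ≤ 1)
    (L : List ι) : ∀ {G : ℝ × ℝ → (ι → ℂ) → ℂ}, IsAmplitude Φ Ψ k l G →
    ∃ C : ℝ, 0 ≤ C ∧ ∀ s s' : ℝ × ℝ, 0 ≤ s → 0 ≤ s' → DerivBound R C L (G s) ∧
      DerivBound R (C * (|s.1 - s'.1| ^ r + |s.2 - s'.2| ^ r)) L (fun z => G s z - G s' z) := by
  induction L with
  | nil =>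
    intro G hG
    obtain ⟨C, hC0, hC⟩ := hG.exists_bound hΦ hΨ hΦ0 hΨ0 R hr hr1
    exact ⟨C, hC0, fun s s' hs hs' => ⟨fun z hz => (hC z hz s s' hs hs').1,
      fun z hz => (hC z hz s s' hs hs').2⟩⟩
  | cons j L ih =>
    intro G hG
    obtain ⟨⟨G', hG', hGd⟩, ⟨H', hH', hHd⟩⟩ := hG.exists_dhol_dbar hΦ hΨ hΦ0 hΨ0 j
    obtain ⟨A, hA0, hA⟩ := ih hG'
    obtain ⟨B, hB0, hB⟩ := ih hH'
    refine ⟨A + B, by positivity, fun s s' hs hs' => ?_⟩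
    have hp : 0 ≤ |s.1 - s'.1| ^ r + |s.2 - s'.2| ^ r := by positivity
    have cs := hG.contDiff hΦ hΨ hΦ0 hΨ0 hs
    have cs' := hG.contDiff hΦ hΨ hΦ0 hΨ0 hs'
    refine ⟨⟨?_, ?_⟩, ⟨?_, ?_⟩⟩
    · rw [hGd s hs]; exact (hA s s' hs hs').1.mono (by linarith) L
    · rw [hHd s hs]; exact (hB s s' hs hs').1.mono (by linarith) L
    · rw [dhol_sub cs cs', hGd s hs, hGd s' hs']
      exact (hA s s' hs hs').2.mono (by gcongr; linarith) L
    · rw [dbar_sub cs cs', hHd s hs, hHd s' hs']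
      exact (hB s s' hs hs').2.mono (by gcongr; linarith) L

/-- The torus averages of an amplitude divided by `ζ^γ` are bounded and Hölder continuous in `s`,
uniformly on a polydisc. -/
lemma IsAmplitude.exists_torusMean_bound {k l : ℕ} {N : ℕ} [NeZero N] (hΦ : ContDiff ℝ ∞ Φ)
    (hΨ : ContDiff ℝ ∞ Ψ) (hΦ0 : ∀ z, 0 < Φ z) (hΨ0 : ∀ z, 0 < Ψ z)
    {G : ℝ × ℝ → (ι → ℂ) → ℂ} (hG : IsAmplitude Φ Ψ k l G) (R : ℝ) {r : ℝ} (hr : 0 ≤ r)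
    (hr1 : r ≤ 1) {γ : ι → ℕ} (hN : ∀ j, 2 * γ j ≤ N) :
    ∃ C : ℝ, 0 ≤ C ∧ ∀ z ∈ polydisc ι R, ∀ s s' : ℝ × ℝ, 0 ≤ s → 0 ≤ s' →
      ‖torusMean N γ (G s) z‖ ≤ C ∧ ‖torusMean N γ (G s) z - torusMean N γ (G s') z‖ ≤
        C * (|s.1 - s'.1| ^ r + |s.2 - s'.2| ^ r) := by
  obtain ⟨L, hL⟩ := exists_list_count γ
  obtain ⟨C, hC0, hC⟩ := hG.exists_derivBound hΦ hΨ hΦ0 hΨ0 R hr hr1 L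
  refine ⟨2 ^ L.length * C, by positivity, fun z hz s s' hs hs' => ?_⟩
  obtain ⟨h1, h2⟩ := hC s s' hs hs'
  have cs := hG.contDiff hΦ hΨ hΦ0 hΨ0 hs
  have cs' := hG.contDiff hΦ hΨ hΦ0 hΨ0 hs'
  refine ⟨norm_torusMean_le hC0 hN hL cs h1 hz, ?_⟩
  rw [← torusMean_sub, mul_assoc]
  exact norm_torusMean_le (by positivity) hN hL (cs.sub cs') h2 hz

end Amplitude

/-! ### Regularized integrals without derivatives of the cutoff functions -/

section Core

variable {ι : Type*} [Fintype ι] [DecidableEq ι] {Φ Ψ : (ι → ℂ) → ℝ}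

lemma monom_smul_add (k l : ℕ) (α β : ι → ℕ) (z : ι → ℂ) :
    monom (k • α + l • β) z = monom α z ^ k * monom β z ^ l := by
  simp only [monom, Pi.add_apply, Pi.smul_apply, smul_eq_mul, pow_add, Finset.prod_mul_distrib,
    ← Finset.prod_pow, ← pow_mul, mul_comm]

lemma integrableOn_norm_monom_rpow {γ : ι → ℕ} {r : ℝ} (hγ : ∀ j, r * γ j < 1) (R : ℝ) :
    IntegrableOn (fun z : ι → ℂ => ((‖monom γ z‖ ^ 2)⁻¹) ^ r) (polydisc ι R) := by
  have h1 : ∀ j, Integrable (fun w : ℂ => ((‖w ^ γ j‖ ^ 2)⁻¹) ^ r)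
      (volume.restrict (Metric.closedBall 0 R)) := by
    intro j
    have hm : AEStronglyMeasurable (fun w : ℂ => ((‖w ^ γ j‖ ^ 2)⁻¹) ^ r) volume :=
      ((by fun_prop : Measurable fun w : ℂ => (‖w ^ γ j‖ ^ 2)⁻¹).pow_const r).aestronglyMeasurable
    refine (integrableOn_ball_of_norm_le_rpow (C := 1) (α := 2 * (r * γ j)) (r := R + 1)
      (by simp [Complex.finrank_real_complex]) ?_ (ae_restrict_of_ae ?_) hm).mono_set
      (Metric.closedBall_subset_ball (by linarith))
    · rw [Complex.finrank_real_complex]; push_cast; linarith [hγ j]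
    · filter_upwards [Measure.ae_ne volume (0 : ℂ)] with w hw
      have hw0 : 0 ≤ ‖w‖ := norm_nonneg w
      rw [Real.norm_of_nonneg (by positivity), one_mul, norm_pow, ← pow_mul,
        ← Real.rpow_natCast, ← Real.rpow_neg hw0, ← Real.rpow_mul hw0]
      refine le_of_eq ?_
      congr 1
      push_cast; ring
  have h2 := Integrable.fintype_prod (𝕜 := ℝ) h1
  rw [IntegrableOn, polydisc_eq_pi, volume_pi, Measure.restrict_pi_pi]
  refine h2.congr (.of_forall fun z => ?_)
  simp only [monom, norm_prod]
  rw [← Finset.prod_pow, ← Finset.prod_inv_distrib, Real.finsetProd_rpow]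
  intro j _; positivity

lemma measurable_symbol_comp {X : Type*} [MeasurableSpace X] {k : ℕ} {a : ℝ → ℂ}
    (ha : IsSymbol k a) {g : X → ℝ} (hg : Measurable g) (hg0 : ∀ x, 0 ≤ g x) :
    Measurable fun x => a (g x) := by
  have hc : Continuous fun s : ℝ => a (max s 0) :=
    ha.1.continuousOn.comp_continuous (by fun_prop) fun t => le_max_right t 0
  have := hc.measurable.comp hg
  simpa only [Function.comp_def, max_eq_left (hg0 _)] using this

/-- The variables `s = (ε₁/|ζ^α|², ε₂/|ζ^β|²)`; the value `0` of a quotient with denominator `0` is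
irrelevant, as it occurs on a null set only. -/
noncomputable def scale (α β : ι → ℕ) (ε : ℝ × ℝ) (z : ι → ℂ) : ℝ × ℝ :=
  (ε.1 / ‖monom α z‖ ^ 2, ε.2 / ‖monom β z‖ ^ 2)

lemma scale_rot {N : ℕ} [NeZero N] (α β : ι → ℕ) (ε : ℝ × ℝ) (a : ι → ZMod N) (z : ι → ℂ) :
    scale α β ε (rot a z) = scale α β ε z := by
  simp only [scale, norm_monom_rot]

lemma scale_nonneg (α β : ι → ℕ) {ε : ℝ × ℝ} (hε : 0 ≤ ε) (z : ι → ℂ) : 0 ≤ scale α β ε z :=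
  ⟨div_nonneg hε.1 (by positivity), div_nonneg hε.2 (by positivity)⟩

/-- The function `c / (ζ^{kα} ζ^{lβ}) · a₁(ε₁/(Φ|ζ^α|²)) a₂(ε₂/(Ψ|ζ^β|²))`. -/
noncomputable def regIntegrand (Φ Ψ : (ι → ℂ) → ℝ) (a₁ a₂ : ℝ → ℂ) (c : (ι → ℂ) → ℂ) (k l : ℕ)
    (α β : ι → ℕ) (ε : ℝ × ℝ) (z : ι → ℂ) : ℂ :=
  (monom (k • α + l • β) z)⁻¹ * ampl Φ Ψ a₁ a₂ c (scale α β ε z) z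

/-- The integral of the torus averages of `regIntegrand`, which makes sense for all `ε ≥ 0`. -/
noncomputable def regIntegral (N : ℕ) [NeZero N] (R : ℝ) (Φ Ψ : (ι → ℂ) → ℝ) (a₁ a₂ : ℝ → ℂ)
    (c : (ι → ℂ) → ℂ) (k l : ℕ) (α β : ι → ℕ) (ε : ℝ × ℝ) : ℂ :=
  ∫ z in polydisc ι R, torusMean N (k • α + l • β) (ampl Φ Ψ a₁ a₂ c (scale α β ε z)) z

lemma measurable_ampl_scale (hΦ : ContDiff ℝ ∞ Φ) (hΨ : ContDiff ℝ ∞ Ψ) (hΦ0 : ∀ z, 0 < Φ z)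
    (hΨ0 : ∀ z, 0 < Ψ z) {k l : ℕ} {a₁ a₂ : ℝ → ℂ} (h₁ : IsSymbol k a₁) (h₂ : IsSymbol l a₂)
    {c : (ι → ℂ) → ℂ} (hc : ContDiff ℝ ∞ c) (α β : ι → ℕ) {ε : ℝ × ℝ} (hε : 0 ≤ ε) :
    Measurable fun z => ampl Φ Ψ a₁ a₂ c (scale α β ε z) z := by
  have hs := scale_nonneg α β hε
  have m : ∀ γ : ι → ℕ, Measurable fun z : ι → ℂ => ‖monom γ z‖ ^ 2 := fun γ =>
    ((continuous_monom γ).norm.pow 2).measurable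
  refine hc.continuous.measurable.mul ((measurable_symbol_comp h₁ ?_ fun z =>
    div_nonneg (hs z).1 (hΦ0 z).le).mul (measurable_symbol_comp h₂ ?_ fun z =>
    div_nonneg (hs z).2 (hΨ0 z).le))
  · exact (measurable_const.div (m α)).div hΦ.continuous.measurable
  · exact (measurable_const.div (m β)).div hΨ.continuous.measurable

lemma exists_bound_symbol_div (hΦ : ContDiff ℝ ∞ Φ) (hΦ0 : ∀ z, 0 < Φ z) {k : ℕ} {a : ℝ → ℂ}
    (ha : IsSymbol k a) (α : ι → ℕ) {ε : ℝ} (hε : 0 < ε) (R : ℝ) :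
    ∃ C : ℝ, 0 ≤ C ∧ ∀ z ∈ polydisc ι R,
      ‖(monom α z ^ k)⁻¹‖ * ‖a (ε / ‖monom α z‖ ^ 2 / Φ z)‖ ≤ C := by
  obtain ⟨A, hA0, hA⟩ := ha.exists_bound
  obtain ⟨E, hE⟩ := (isCompact_polydisc (ι := ι) R).exists_bound_of_continuousOn
    (f := fun z => (‖monom α z‖ * Φ z / ε) ^ k)
    ((((continuous_monom α).norm.mul hΦ.continuous).div_const ε).pow k).continuousOn
  refine ⟨A + |E| * A, by positivity, fun z hz => ?_⟩
  have h0 : 0 ≤ ε / ‖monom α z‖ ^ 2 / Φ z := by have := hΦ0 z; positivity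
  rcases eq_or_ne (monom α z) 0 with h | h
  · have h1 : ‖(monom α z ^ k)⁻¹‖ ≤ 1 := by
      rw [h]; rcases k with _ | k <;> simp
    calc _ ≤ 1 * A := mul_le_mul h1 (hA _ h0).1 (norm_nonneg _) zero_le_one
      _ ≤ _ := by rw [one_mul]; exact le_add_of_nonneg_right (by positivity)
  · have hm : 0 < ‖monom α z‖ := norm_pos_iff.2 h
    have hp := hΦ0 z
    set σ := ε / ‖monom α z‖ ^ 2 / Φ z with hσ
    have e : ‖(monom α z ^ k)⁻¹‖ = (‖monom α z‖ * Φ z / ε) ^ k * σ ^ k := by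
      rw [norm_inv, norm_pow, ← mul_pow, ← inv_pow, hσ]
      congr 1
      field_simp
    rw [e, mul_assoc]
    calc _ ≤ |E| * A := mul_le_mul ((le_abs_self _).trans ((hE z hz).trans (le_abs_self E)))
          (hA σ h0).2 (by positivity) (abs_nonneg _)
      _ ≤ _ := le_add_of_nonneg_left hA0

lemma integrable_regIntegrand (hΦ : ContDiff ℝ ∞ Φ) (hΨ : ContDiff ℝ ∞ Ψ) (hΦ0 : ∀ z, 0 < Φ z)
    (hΨ0 : ∀ z, 0 < Ψ z) {k l : ℕ} {a₁ a₂ : ℝ → ℂ} (h₁ : IsSymbol k a₁) (h₂ : IsSymbol l a₂)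
    {c : (ι → ℂ) → ℂ} (hc : ContDiff ℝ ∞ c) {R : ℝ} (hcR : ∀ z ∉ polydisc ι R, c z = 0)
    (α β : ι → ℕ) {ε : ℝ × ℝ} (hε₁ : 0 < ε.1) (hε₂ : 0 < ε.2) :
    Integrable (regIntegrand Φ Ψ a₁ a₂ c k l α β ε) := by
  have hsupp : ∀ z ∉ polydisc ι R, regIntegrand Φ Ψ a₁ a₂ c k l α β ε z = 0 := fun z hz => by
    simp [regIntegrand, ampl, hcR z hz]
  refine IntegrableOn.integrable_of_forall_notMem_eq_zero (s := polydisc ι R) ?_ hsupp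
  obtain ⟨A, hA0, hA⟩ := exists_bound_symbol_div hΦ hΦ0 h₁ α hε₁ R
  obtain ⟨B, hB0, hB⟩ := exists_bound_symbol_div hΨ hΨ0 h₂ β hε₂ R
  obtain ⟨D, hD⟩ := (isCompact_polydisc (ι := ι) R).exists_bound_of_continuousOn
    hc.continuous.continuousOn
  refine Integrable.mono' (g := fun _ => |D| * (A * B))
    (integrableOn_const (isCompact_polydisc R).measure_lt_top.ne) ?_ ?_
  · exact ((continuous_monom _).measurable.inv.mul (measurable_ampl_scale hΦ hΨ hΦ0 hΨ0 h₁ h₂ hc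
      α β (show (0 : ℝ × ℝ) ≤ ε from ⟨hε₁.le, hε₂.le⟩))).aestronglyMeasurable
  · refine (ae_restrict_iff' (measurableSet_polydisc R)).2 (.of_forall fun z hz => ?_)
    rw [regIntegrand, ampl, monom_smul_add, mul_inv]
    simp only [norm_mul]
    calc _ = ‖c z‖ * ((‖(monom α z ^ k)⁻¹‖ * ‖a₁ (ε.1 / ‖monom α z‖ ^ 2 / Φ z)‖) *
          (‖(monom β z ^ l)⁻¹‖ * ‖a₂ (ε.2 / ‖monom β z‖ ^ 2 / Ψ z)‖)) := by
          simp only [scale]; ring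
      _ ≤ _ := mul_le_mul ((hD z hz).trans (le_abs_self D)) (mul_le_mul (hA z hz) (hB z hz)
          (by positivity) hA0) (by positivity) (abs_nonneg _)

/-- For `ε > 0` the regularized integral does not change under averaging over the torus. -/
lemma integral_regIntegrand (N : ℕ) [NeZero N] (hΦ : ContDiff ℝ ∞ Φ) (hΨ : ContDiff ℝ ∞ Ψ)
    (hΦ0 : ∀ z, 0 < Φ z) (hΨ0 : ∀ z, 0 < Ψ z) {k l : ℕ} {a₁ a₂ : ℝ → ℂ} (h₁ : IsSymbol k a₁)
    (h₂ : IsSymbol l a₂) {c : (ι → ℂ) → ℂ} (hc : ContDiff ℝ ∞ c) {R : ℝ}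
    (hcR : ∀ z ∉ polydisc ι R, c z = 0) (α β : ι → ℕ) {ε : ℝ × ℝ} (hε₁ : 0 < ε.1)
    (hε₂ : 0 < ε.2) : ∫ z, regIntegrand Φ Ψ a₁ a₂ c k l α β ε z =
      regIntegral N R Φ Ψ a₁ a₂ c k l α β ε := by
  have hint := integrable_regIntegrand hΦ hΨ hΦ0 hΨ0 h₁ h₂ hc hcR α β hε₁ hε₂
  have hsupp : ∀ z ∉ polydisc ι R, regIntegrand Φ Ψ a₁ a₂ c k l α β ε z = 0 := fun z hz => by
    simp [regIntegrand, ampl, hcR z hz]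
  rw [← setIntegral_eq_integral_of_forall_compl_eq_zero hsupp,
    setIntegral_eq_average N hint.integrableOn]
  simp only [regIntegrand, scale_rot, regIntegral, torusMean]

lemma regIntegral_zero (N : ℕ) [NeZero N] (R : ℝ) (a₁ a₂ : ℝ → ℂ) (c : (ι → ℂ) → ℂ) (k l : ℕ)
    (α β : ι → ℕ) : regIntegral N R Φ Ψ a₁ a₂ c k l α β 0 =
      a₁ 0 * a₂ 0 * ∫ z in polydisc ι R, torusMean N (k • α + l • β) c z := by
  rw [regIntegral, ← integral_const_mul]
  congr 1
  ext z
  simp only [torusMean, ampl, scale, Prod.fst_zero, Prod.snd_zero, zero_div, Finset.mul_sum]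
  exact Finset.sum_congr rfl fun a _ => by ring

/-- The regularized integrals are Hölder continuous on `[0,∞)²`: the torus averages of the
integrand are Hölder continuous in `s = (ε₁/|ζ^α|², ε₂/|ζ^β|²)`, and `|ζ^α|^{-2r}` and
`|ζ^β|^{-2r}` are integrable. -/
lemma exists_regIntegral_holder (N : ℕ) [NeZero N] (hΦ : ContDiff ℝ ∞ Φ) (hΨ : ContDiff ℝ ∞ Ψ)
    (hΦ0 : ∀ z, 0 < Φ z) (hΨ0 : ∀ z, 0 < Ψ z) {k l : ℕ} {a₁ a₂ : ℝ → ℂ} (h₁ : IsSymbol k a₁)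
    (h₂ : IsSymbol l a₂) {c : (ι → ℂ) → ℂ} (hc : ContDiff ℝ ∞ c) (R : ℝ) {α β : ι → ℕ}
    (hN : ∀ j, 2 * (k • α + l • β) j ≤ N) {r : ℝ} (hr : 0 ≤ r) (hr1 : r ≤ 1)
    (hα : ∀ j, r * α j < 1) (hβ : ∀ j, r * β j < 1) :
    ∃ C : ℝ, 0 ≤ C ∧ ∀ ε ε' : ℝ × ℝ, 0 ≤ ε → 0 ≤ ε' →
      ‖regIntegral N R Φ Ψ a₁ a₂ c k l α β ε - regIntegral N R Φ Ψ a₁ a₂ c k l α β ε'‖ ≤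
        C * (|ε.1 - ε'.1| ^ r + |ε.2 - ε'.2| ^ r) := by
  obtain ⟨C, hC0, hC⟩ := (IsAmplitude.ampl (Φ := Φ) (Ψ := Ψ) h₁ h₂ hc).exists_torusMean_bound
    hΦ hΨ hΦ0 hΨ0 R hr hr1 hN
  have iα := integrableOn_norm_monom_rpow hα R
  have iβ := integrableOn_norm_monom_rpow hβ R
  set A := ∫ z in polydisc ι R, ((‖monom α z‖ ^ 2)⁻¹) ^ r with hA
  set B := ∫ z in polydisc ι R, ((‖monom β z‖ ^ 2)⁻¹) ^ r with hB
  have hA0 : 0 ≤ A := integral_nonneg fun z => by positivity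
  have hB0 : 0 ≤ B := integral_nonneg fun z => by positivity
  have hint : ∀ ε : ℝ × ℝ, 0 ≤ ε → IntegrableOn
      (fun z => torusMean N (k • α + l • β) (ampl Φ Ψ a₁ a₂ c (scale α β ε z)) z)
      (polydisc ι R) := by
    intro ε hε
    refine Integrable.mono' (g := fun _ => C)
      (integrableOn_const (isCompact_polydisc R).measure_lt_top.ne) ?_ ?_
    · have e : (fun z => torusMean N (k • α + l • β) (ampl Φ Ψ a₁ a₂ c (scale α β ε z)) z) =
          torusMean N (k • α + l • β) fun z => ampl Φ Ψ a₁ a₂ c (scale α β ε z) z := by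
        ext z; simp only [torusMean, scale_rot]
      rw [e]
      exact (measurable_torusMean _
        (measurable_ampl_scale hΦ hΨ hΦ0 hΨ0 h₁ h₂ hc α β hε)).aestronglyMeasurable
    · exact (ae_restrict_iff' (measurableSet_polydisc R)).2 (.of_forall fun z hz =>
        (hC z hz _ _ (scale_nonneg α β hε z) (scale_nonneg α β hε z)).1)
  refine ⟨C * (A + B), by positivity, fun ε ε' hε hε' => ?_⟩
  rw [regIntegral, regIntegral, ← integral_sub (hint ε hε) (hint ε' hε')]
  have hbi : IntegrableOn (fun z => C * (|ε.1 - ε'.1| ^ r * ((‖monom α z‖ ^ 2)⁻¹) ^ r +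
      |ε.2 - ε'.2| ^ r * ((‖monom β z‖ ^ 2)⁻¹) ^ r)) (polydisc ι R) :=
    ((iα.const_mul _).add (iβ.const_mul _)).const_mul C
  refine (norm_integral_le_of_norm_le hbi ((ae_restrict_iff' (measurableSet_polydisc R)).2
    (.of_forall fun z hz => ?_))).trans ?_
  · refine (hC z hz _ _ (scale_nonneg α β hε z) (scale_nonneg α β hε' z)).2.trans (le_of_eq ?_)
    have e : ∀ x y m : ℝ, 0 ≤ m → |x / m - y / m| ^ r = |x - y| ^ r * (m⁻¹) ^ r := by
      intro x y m hm
      rw [← sub_div, abs_div, abs_of_nonneg hm, div_eq_mul_inv,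
        Real.mul_rpow (abs_nonneg _) (inv_nonneg.2 hm)]
    simp only [scale]
    rw [e _ _ _ (by positivity), e _ _ _ (by positivity)]
  · rw [integral_const_mul, integral_add (iα.const_mul _) (iβ.const_mul _), integral_const_mul,
      integral_const_mul, ← hA, ← hB, mul_assoc]
    refine mul_le_mul_of_nonneg_left ?_ hC0
    have p1 : 0 ≤ |ε.1 - ε'.1| ^ r := by positivity
    have p2 : 0 ≤ |ε.2 - ε'.2| ^ r := by positivity
    nlinarith [mul_nonneg p1 hB0, mul_nonneg p2 hA0]

end Core

/-! ### Tensor products of principal values and residues -/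

section Tensor

variable {ι : Type*} [Fintype ι] [DecidableEq ι]

lemma fderiv_eq_zero_of_notMem {R : ℝ} {u : (ι → ℂ) → ℂ} (hu : ∀ z ∉ polydisc ι R, u z = 0)
    {z : ι → ℂ} (hz : z ∉ polydisc ι R) : fderiv ℝ u z = 0 := by
  have h : u =ᶠ[𝓝 z] fun _ => 0 := by
    filter_upwards [(isCompact_polydisc (ι := ι) R).isClosed.isOpen_compl.mem_nhds hz] with w hw
    exact hu w hw
  rw [h.fderiv_eq, fderiv_const_apply]

lemma dbar_eq_zero_of_notMem {R : ℝ} {u : (ι → ℂ) → ℂ} (hu : ∀ z ∉ polydisc ι R, u z = 0)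
    (j : ι) {z : ι → ℂ} (hz : z ∉ polydisc ι R) : dbar u j z = 0 := by
  simp [dbar, fderiv_eq_zero_of_notMem hu hz]

lemma exists_forall_norm_le {R : ℝ} {u : (ι → ℂ) → ℂ} (hc : Continuous u)
    (hu : ∀ z ∉ polydisc ι R, u z = 0) : ∃ D, ∀ z, ‖u z‖ ≤ D := by
  obtain ⟨D, hD⟩ := (isCompact_polydisc (ι := ι) R).exists_bound_of_continuousOn hc.continuousOn
  refine ⟨|D|, fun z => ?_⟩
  by_cases hz : z ∈ polydisc ι R
  · exact (hD z hz).trans (le_abs_self D)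
  · rw [hu z hz, norm_zero]; positivity

lemma exists_derivBound (R : ℝ) (L : List ι) : ∀ {g : (ι → ℂ) → ℂ}, ContDiff ℝ ∞ g →
    ∃ B, 0 ≤ B ∧ DerivBound R B L g := by
  induction L with
  | nil =>
    intro g hg
    obtain ⟨D, hD⟩ := (isCompact_polydisc (ι := ι) R).exists_bound_of_continuousOn
      hg.continuous.continuousOn
    exact ⟨|D|, abs_nonneg D, fun z hz => (hD z hz).trans (le_abs_self D)⟩
  | cons j L ih =>
    intro g hg
    obtain ⟨A, hA0, hA⟩ := ih (contDiff_dhol hg j)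
    obtain ⟨B, hB0, hB⟩ := ih (contDiff_dbar hg j)
    exact ⟨A + B, by positivity, hA.mono (by linarith) L, hB.mono (by linarith) L⟩

variable (p : ι → Prop) [DecidablePred p]

lemma contDiff_glue (x : {j // p j} → ℂ) : ContDiff ℝ ∞ (glue p x) := by
  refine contDiff_pi.2 fun j => ?_
  by_cases h : p j
  · simpa only [glue, h, dite_true] using contDiff_const
  · simpa only [glue, h, dite_false] using contDiff_apply ℝ ℂ (⟨j, h⟩ : {j // ¬ p j})

lemma glue_mem_polydisc {R : ℝ} {x : {j // p j} → ℂ} {y : {j // ¬ p j} → ℂ} :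
    glue p x y ∈ polydisc ι R ↔ x ∈ polydisc _ R ∧ y ∈ polydisc _ R := by
  constructor
  · intro h
    refine ⟨fun j => ?_, fun j => ?_⟩
    · simpa [glue, j.2] using h j
    · simpa [glue, j.2] using h j
  · rintro ⟨h1, h2⟩ j
    by_cases h : p j
    · simpa [glue, h] using h1 ⟨j, h⟩
    · simpa [glue, h] using h2 ⟨j, h⟩

lemma fderiv_comp_glue {u : (ι → ℂ) → ℂ} (hu : ContDiff ℝ ∞ u) (x : {j // p j} → ℂ)
    (y : {j // ¬ p j} → ℂ) (j : {j // ¬ p j}) (w : ℂ) :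
    fderiv ℝ (fun y => u (glue p x y)) y (Pi.single j w) =
      fderiv ℝ u (glue p x y) (Pi.single (j : ι) w) := by
  have hd : Differentiable ℝ fun y => u (glue p x y) :=
    (hu.comp (contDiff_glue p x)).differentiable (by simp)
  rw [← (hd y).lineDeriv_eq_fderiv,
    ← (hu.differentiable (by simp) (glue p x y)).lineDeriv_eq_fderiv]
  simp only [lineDeriv]
  congr 1
  ext t
  congr 1
  ext i
  by_cases h : p i
  · have hi : i ≠ j := fun e => j.2 (e ▸ h)
    simp [glue, h, hi]
  · by_cases hi : i = j
    · subst hi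
      simp [glue, j.2]
    · have hi' : (⟨i, h⟩ : {j // ¬ p j}) ≠ j := fun e => hi (congrArg Subtype.val e)
      simp [glue, h, hi, hi']

lemma dbar_comp_glue {u : (ι → ℂ) → ℂ} (hu : ContDiff ℝ ∞ u) (x : {j // p j} → ℂ)
    (j : {j // ¬ p j}) :
    dbar (fun y => u (glue p x y)) j = fun y => dbar u (j : ι) (glue p x y) := by
  ext y; simp only [dbar, fderiv_comp_glue p hu]

lemma dhol_comp_glue {u : (ι → ℂ) → ℂ} (hu : ContDiff ℝ ∞ u) (x : {j // p j} → ℂ)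
    (j : {j // ¬ p j}) :
    dhol (fun y => u (glue p x y)) j = fun y => dhol u (j : ι) (glue p x y) := by
  ext y; simp only [dhol, fderiv_comp_glue p hu]

lemma DerivBound.comp_glue {R B : ℝ} {x : {j // p j} → ℂ} (hx : x ∈ polydisc _ R)
    (L : List {j // ¬ p j}) : ∀ {g : (ι → ℂ) → ℂ}, ContDiff ℝ ∞ g →
    DerivBound R B (L.map Subtype.val) g → DerivBound R B L (fun y => g (glue p x y)) := by
  induction L with
  | nil => exact fun _ h y hy => h _ ((glue_mem_polydisc p).2 ⟨hx, hy⟩)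
  | cons j L ih =>
    intro g hg h
    rw [List.map_cons] at h
    refine ⟨?_, ?_⟩
    · rw [dhol_comp_glue p hg]; exact ih (contDiff_dhol hg j) h.1
    · rw [dbar_comp_glue p hg]; exact ih (contDiff_dbar hg j) h.2

lemma monom_glue (M : ι → ℕ) (x : {j // p j} → ℂ) (y : {j // ¬ p j} → ℂ) :
    monom M (glue p x y) = monom (fun j : {j // p j} => M j) x *
      monom (fun j : {j // ¬ p j} => M j) y := by
  rw [monom, ← Fintype.prod_subtype_mul_prod_subtype p]
  congr 1
  · exact Finset.prod_congr rfl fun j _ => by simp [glue, j.2]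
  · exact Finset.prod_congr rfl fun j _ => by simp [glue, j.2]

variable {N : ℕ} [NeZero N]

/-- The torus average splits into the averages over the two groups of variables. -/
lemma torusMean_glue (M : ι → ℕ) (ψ : (ι → ℂ) → ℂ) (x : {j // p j} → ℂ)
    (y : {j // ¬ p j} → ℂ) :
    torusMean N M ψ (glue p x y) = torusMean N (fun j : {j // p j} => M j)
      (fun x => torusMean N (fun j : {j // ¬ p j} => M j) (fun y => ψ (glue p x y)) y) x := by
  have e := Equiv.piEquivPiSubtypeProd p (fun _ => ZMod N)
  have hcard : Fintype.card (ι → ZMod N) = Fintype.card ({j // p j} → ZMod N) *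
      Fintype.card ({j // ¬ p j} → ZMod N) := by
    rw [← Fintype.card_prod]; exact Fintype.card_congr e
  have hrot : ∀ (a : {j // p j} → ZMod N) (b : {j // ¬ p j} → ZMod N),
      rot ((Equiv.piEquivPiSubtypeProd p (fun _ => ZMod N)).symm (a, b)) (glue p x y) =
        glue p (rot a x) (rot b y) := by
    intro a b
    ext j
    by_cases h : p j <;> simp [rot, glue, h]
  simp only [torusMean]
  rw [← Equiv.sum_comp (Equiv.piEquivPiSubtypeProd p (fun _ => ZMod N)).symm,
    Fintype.sum_prod_type, hcard]
  simp only [hrot, monom_glue, Finset.mul_sum]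
  refine Finset.sum_congr rfl fun a _ => Finset.sum_congr rfl fun b _ => ?_
  push_cast
  rw [mul_inv, mul_inv]
  ring

lemma measurable_glue : Measurable fun q : ({j // p j} → ℂ) × ({j // ¬ p j} → ℂ) =>
    glue p q.1 q.2 :=
  (MeasurableEquiv.piEquivPiSubtypeProd (fun _ : ι => ℂ) p).symm.measurable

/-- Fubini's theorem for the splitting of the variables into two groups. -/
lemma setIntegral_glue {R : ℝ} {F : (ι → ℂ) → ℂ} (hF : IntegrableOn F (polydisc ι R)) :
    ∫ x in polydisc {j // p j} R, ∫ y in polydisc {j // ¬ p j} R, F (glue p x y) =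
      ∫ z in polydisc ι R, F z := by
  have hp := (volume_preserving_piEquivPiSubtypeProd (fun _ : ι => ℂ) p).symm
  have hpre : (MeasurableEquiv.piEquivPiSubtypeProd (fun _ : ι => ℂ) p).symm ⁻¹' polydisc ι R =
      polydisc {j // p j} R ×ˢ polydisc {j // ¬ p j} R := by
    ext q
    exact glue_mem_polydisc p (x := q.1) (y := q.2)
  have h1 := hp.setIntegral_preimage_emb
    (MeasurableEquiv.piEquivPiSubtypeProd (fun _ : ι => ℂ) p).symm.measurableEmbedding F
    (polydisc ι R)
  have h2 := (hp.integrableOn_comp_preimage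
    (MeasurableEquiv.piEquivPiSubtypeProd (fun _ : ι => ℂ) p).symm.measurableEmbedding
    (f := F) (s := polydisc ι R)).2 hF
  rw [hpre] at h1 h2
  rw [← h1]
  exact (setIntegral_prod _ h2).symm

lemma integrableOn_torusMean {M : ι → ℕ} {ψ : (ι → ℂ) → ℂ} (hψ : Continuous ψ) {R C : ℝ}
    (hC : ∀ z ∈ polydisc ι R, ‖torusMean N M ψ z‖ ≤ C) :
    IntegrableOn (torusMean N M ψ) (polydisc ι R) :=
  Integrable.mono' (g := fun _ => C)
    (integrableOn_const (isCompact_polydisc R).measure_lt_top.ne)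
    (measurable_torusMean M hψ.measurable).aestronglyMeasurable
    ((ae_restrict_iff' (measurableSet_polydisc R)).2 (.of_forall hC))

lemma exists_torusMean_le {M : ι → ℕ} (hN : ∀ j, 2 * M j ≤ N) {ψ : (ι → ℂ) → ℂ}
    (hψ : ContDiff ℝ ∞ ψ) (R : ℝ) : ∃ C, 0 ≤ C ∧ ∀ z ∈ polydisc ι R, ‖torusMean N M ψ z‖ ≤ C := by
  obtain ⟨L, hL⟩ := exists_list_count M
  obtain ⟨B, hB0, hB⟩ := exists_derivBound R L hψ
  exact ⟨2 ^ L.length * B, by positivity, fun z hz => norm_torusMean_le hB0 hN hL hψ hB hz⟩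

lemma exists_torusMean_glue_le {M : ι → ℕ} (hN : ∀ j, 2 * M j ≤ N) {ψ : (ι → ℂ) → ℂ}
    (hψ : ContDiff ℝ ∞ ψ) {R : ℝ} (hψR : ∀ z ∉ polydisc ι R, ψ z = 0) :
    ∃ C, 0 ≤ C ∧ ∀ (x : {j // p j} → ℂ), ∀ y ∈ polydisc {j // ¬ p j} R,
      ‖torusMean N (fun j : {j // ¬ p j} => M j) (fun y => ψ (glue p x y)) y‖ ≤ C := by
  obtain ⟨L, hL⟩ := exists_list_count fun j : {j // ¬ p j} => M j
  obtain ⟨B, hB0, hB⟩ := exists_derivBound R (L.map Subtype.val) hψ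
  refine ⟨2 ^ L.length * B, by positivity, fun x y hy => ?_⟩
  by_cases hx : x ∈ polydisc _ R
  · exact norm_torusMean_le (γ := fun j : {j // ¬ p j} => M j) hB0 (fun j => hN j) hL (hψ.comp (contDiff_glue p x))
      (hB.comp_glue p hx L hψ) hy
  · have h0 : (fun y => ψ (glue p x y)) = fun _ => 0 := by
      ext y
      exact hψR _ fun h => hx ((glue_mem_polydisc p).1 h).1
    rw [h0]
    simp only [torusMean, mul_zero, Finset.sum_const_zero, norm_zero]
    positivity

variable (N) in
/-- The tensor product `[1/ζ^a] ⊗ ∂̄[1/ζ^b]` applied to `φ` is the integral of torus averages. -/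
lemma hasTensorResidue_torusMean {a b M : ι → ℕ} (hN : ∀ j, 2 * M j ≤ N)
    (ha : ∀ j, p j → M j = a j) (hb : ∀ j, ¬ p j → M j = b j) (φ : TestForm ι) {R : ℝ}
    (hφ : ∀ j, ∀ z ∉ polydisc ι R, φ.coeff j z = 0) :
    HasTensorResidue p a b φ
      (-∫ z in polydisc ι R, torusMean N M (fun z => ∑ j : {j // ¬ p j}, dbar (φ.coeff j) j z) z) := by
  set ψ : (ι → ℂ) → ℂ := fun z => ∑ j : {j // ¬ p j}, dbar (φ.coeff j) j z with hψdef
  have hψ : ContDiff ℝ ∞ ψ := ContDiff.sum fun j _ => contDiff_dbar (φ.smooth j) j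
  have hψR : ∀ z ∉ polydisc ι R, ψ z = 0 := fun z hz =>
    Finset.sum_eq_zero fun j _ => dbar_eq_zero_of_notMem (hφ j) j hz
  obtain ⟨D, hD⟩ := exists_forall_norm_le hψ.continuous hψR
  obtain ⟨C, hC0, hC⟩ := exists_torusMean_glue_le (N := N) p hN hψ hψR
  obtain ⟨C', hC'0, hC'⟩ := exists_torusMean_le (N := N) hN hψ R
  have ea : (fun j : {j // p j} => M j) = fun j : {j // p j} => a j :=
    funext fun j => ha j j.2
  have eb : (fun j : {j // ¬ p j} => M j) = fun j : {j // ¬ p j} => b j :=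
    funext fun j => hb j j.2
  set T : ({j // p j} → ℂ) → ({j // ¬ p j} → ℂ) → ℂ := fun x y =>
    torusMean N (fun j : {j // ¬ p j} => M j) (fun y => ψ (glue p x y)) y with hT
  have hTint : ∀ x, IntegrableOn (T x) (polydisc {j // ¬ p j} R) := fun x =>
    integrableOn_torusMean (hψ.continuous.comp (contDiff_glue p x).continuous) (hC x)
  set v : ({j // p j} → ℂ) → ℂ := fun x => -∫ y in polydisc {j // ¬ p j} R, T x y with hv
  have hTm : Measurable fun q : ({j // p j} → ℂ) × ({j // ¬ p j} → ℂ) => T q.1 q.2 := by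
    simp only [hT, torusMean]
    refine Measurable.const_mul (Finset.measurable_sum _ fun a _ => Measurable.mul ?_ ?_) _
    · exact (((continuous_monom _).comp (continuous_rot a)).measurable.comp measurable_snd).inv
    · exact hψ.continuous.measurable.comp ((measurable_glue p).comp
        (measurable_fst.prodMk ((continuous_rot a).measurable.comp measurable_snd)))
  have hvm : Measurable v :=
    (hTm.stronglyMeasurable.integral_prod_right
      (ν := volume.restrict (polydisc {j // ¬ p j} R))).measurable.neg
  have hvbd : ∀ x, ‖v x‖ ≤ C * (volume : Measure ({j // ¬ p j} → ℂ)).real (polydisc _ R) := by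
    intro x
    rw [hv, norm_neg]
    exact norm_setIntegral_le_of_norm_le_const (isCompact_polydisc R).measure_lt_top (hC x)
  have hvR : ∀ x ∉ polydisc {j // p j} R, v x = 0 := by
    intro x hx
    have h0 : ∀ y, ψ (glue p x y) = 0 := fun y =>
      hψR _ fun h => hx ((glue_mem_polydisc p).1 h).1
    simp only [hv, hT, torusMean, h0, mul_zero, Finset.sum_const_zero, integral_zero, neg_zero]
  -- averaging `v` in `x` yields the full torus average, integrated over `y`
  have hmean : ∀ x, torusMean N (fun j : {j // p j} => M j) v x =
      -∫ y in polydisc {j // ¬ p j} R, torusMean N M ψ (glue p x y) := by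
    intro x
    simp only [torusMean_glue]
    have h1 : ∀ y, torusMean N (fun j : {j // p j} => M j) (fun x => T x y) x =
        (Fintype.card ({j // p j} → ZMod N) : ℂ)⁻¹ * ∑ a : {j // p j} → ZMod N,
          (monom (fun j : {j // p j} => M j) (rot a x))⁻¹ * T (rot a x) y := fun y => rfl
    simp only [hT] at h1
    simp only [h1]
    rw [integral_const_mul, integral_finsetSum _ fun a _ => (hTint _).const_mul _]
    simp only [torusMean, integral_const_mul, hv, hT, mul_neg, Finset.sum_neg_distrib]
  refine ⟨v, fun x => ?_, ?_⟩
  · have h := hasPrincipalValue_of_torusMean (N := N) (γ := fun j : {j // ¬ p j} => M j)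
      (ψ := fun y => ψ (glue p x y)) (R := R)
      (hψ.continuous.comp (contDiff_glue p x).continuous).measurable (fun y => hD _)
      (fun y hy => hψR _ fun h => hy ((glue_mem_polydisc p).1 h).2) (hC x)
    rw [eb] at h
    rw [HasResidue]
    simp only [dbar_comp_glue p (φ.smooth _)]
    rw [hv, neg_neg]
    simpa only [hT, eb] using h
  · have h := hasPrincipalValue_of_torusMean (N := N) (γ := fun j : {j // p j} => M j)
      (C := C' * (volume : Measure ({j // ¬ p j} → ℂ)).real (polydisc _ R)) hvm hvbd hvR
      (fun x hx => by
        rw [hmean, norm_neg]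
        exact norm_setIntegral_le_of_norm_le_const (isCompact_polydisc R).measure_lt_top
          fun y hy => hC' _ ((glue_mem_polydisc p).2 ⟨hx, hy⟩))
    simp only [hmean] at h
    rw [integral_neg, setIntegral_glue p (integrableOn_torusMean hψ.continuous hC')] at h
    rwa [ea] at h

end Tensor

/-! ### Integration by parts -/

section Parts

variable {n : ℕ}

lemma dbar_mul {ι : Type*} [Fintype ι] [DecidableEq ι] {u v : (ι → ℂ) → ℂ} {z : ι → ℂ}
    (hu : DifferentiableAt ℝ u z) (hv : DifferentiableAt ℝ v z) (j : ι) :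
    dbar (fun z => u z * v z) j z = dbar u j z * v z + u z * dbar v j z := by
  simp only [dbar, fderiv_fun_mul hu hv, add_apply, smul_apply, smul_eq_mul]
  ring

lemma contDiff_monom (γ : Fin n → ℕ) : ContDiff ℝ ∞ (monom γ) :=
  contDiff_prod fun j _ => (contDiff_apply ℝ ℂ j).pow _

lemma fderiv_monom (γ : Fin n → ℕ) {z : Fin n → ℂ} {j : Fin n} (hz : z j ≠ 0) (w : ℂ) :
    fderiv ℝ (monom γ) z (Pi.single j w) = γ j * (w / z j) * monom γ z := by
  rw [← ((contDiff_monom γ).differentiable (by simp) z).lineDeriv_eq_fderiv, lineDeriv]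
  have h1 : (fun t : ℝ => monom γ (z + t • (Pi.single j w : Fin n → ℂ))) =
      fun t : ℝ => (z j + t * w) ^ γ j * ∏ i ∈ Finset.univ.erase j, z i ^ γ i := by
    ext t
    rw [monom, ← Finset.mul_prod_erase _ _ (Finset.mem_univ j)]
    congr 1
    · simp
    · refine Finset.prod_congr rfl fun i hi => ?_
      simp [Finset.ne_of_mem_erase hi]
  have h2 : HasDerivAt (fun t : ℝ => z j + t * w) w 0 := by
    simpa using ((hasDerivAt_id (0 : ℝ)).ofReal_comp.mul_const w).const_add (z j)
  rw [h1, ((h2.fun_pow (γ j)).mul_const _).deriv, monom,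
    ← Finset.mul_prod_erase _ _ (Finset.mem_univ j)]
  rcases γ j with _ | m
  · simp
  · simp only [Complex.ofReal_zero, zero_mul, add_zero, Nat.add_sub_cancel]
    field_simp
    ring

lemma dbar_inv_monom (γ : Fin n → ℕ) {z : Fin n → ℂ} (hz : ∀ i, z i ≠ 0) (j : Fin n) :
    dbar (fun z => (monom γ z)⁻¹) j z = 0 := by
  have hm : monom γ z ≠ 0 := Finset.prod_ne_zero_iff.2 fun j _ => pow_ne_zero _ (hz j)
  have hd := ((contDiff_monom γ).differentiable (by simp) z).hasFDerivAt
  have h1 : ∀ w, fderiv ℝ (fun z => (monom γ z)⁻¹) z (Pi.single j w) =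
      -(monom γ z ^ 2)⁻¹ * (γ j * (w / z j) * monom γ z) := by
    intro w
    have := (hasFDerivAt_inv (𝕜 := ℂ) hm).restrictScalars ℝ |>.comp z hd
    rw [show (fun z => (monom γ z)⁻¹) = (fun x => x⁻¹) ∘ monom γ from rfl, this.fderiv]
    simp [fderiv_monom γ (hz j), mul_comm]
  rw [dbar, h1, h1]
  linear_combination (-(monom γ z ^ 2)⁻¹ * γ j * (z j)⁻¹ * monom γ z / 2) * Complex.I_sq

/-- The coefficients of `∂̄Φ/Φ`, for positive `Φ`. -/
noncomputable def dbarLog (Φ : (Fin n → ℂ) → ℝ) (j : Fin n) (z : Fin n → ℂ) : ℂ :=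
  (((fderiv ℝ Φ z (Pi.single j 1) / Φ z : ℝ) : ℂ) +
    Complex.I * ((fderiv ℝ Φ z (Pi.single j Complex.I) / Φ z : ℝ) : ℂ)) / 2

variable {Φ Ψ : (Fin n → ℂ) → ℝ}

lemma contDiff_dbarLog (hΦ : ContDiff ℝ ∞ Φ) (hΦ0 : ∀ z, 0 < Φ z) (j : Fin n) :
    ContDiff ℝ ∞ (dbarLog Φ j) := by
  have h : ∀ w, ContDiff ℝ ∞ fun z => ((fderiv ℝ Φ z w / Φ z : ℝ) : ℂ) := fun w =>
    Complex.ofRealCLM.contDiff.comp (((hΦ.fderiv_right (m := ∞) (by simp)).clm_apply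
      contDiff_const).div hΦ fun z => (hΦ0 z).ne')
  exact ((h _).add (contDiff_const.mul (h _))).div_const 2

variable {χ : ℝ≥0∞ → ℂ} {k : ℕ} {γ : Fin n → ℕ} {ε : ℝ}

lemma contDiff_norm_monom_sq (γ : Fin n → ℕ) :
    ContDiff ℝ ∞ fun z : Fin n → ℂ => ‖monom γ z‖ ^ 2 :=
  (contDiff_monom γ).norm_sq ℝ

lemma contDiff_cutoff (hχ : SmoothExt χ) (hΦ : ContDiff ℝ ∞ Φ) (hΦ0 : ∀ z, 0 < Φ z)
    (hε : 0 < ε) : ContDiff ℝ ∞ (cutoff χ Φ γ ε) :=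
  hχ.1.comp_contDiff ((hΦ.mul (contDiff_norm_monom_sq γ)).div_const ε)
    fun z => div_nonneg (mul_nonneg (hΦ0 z).le (by positivity)) hε.le

lemma cutoff_eq (hΦ0 : ∀ z, 0 < Φ z) (hε : 0 < ε) {z : Fin n → ℂ} (hz : monom γ z ≠ 0) :
    cutoff χ Φ γ ε z = χ (ENNReal.ofReal (ε / ‖monom γ z‖ ^ 2 / Φ z))⁻¹ := by
  have hm : 0 < ‖monom γ z‖ := norm_pos_iff.2 hz
  have hp := hΦ0 z
  rw [cutoff, ← ENNReal.ofReal_inv_of_pos (by positivity)]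
  congr 2
  field_simp

/-- The formula `∂̄(χ(t)) = tχ'(t) (∂̄Φ/Φ + ∑ γ_j dζ̄_j/ζ̄_j)` for `t = Φ|ζ^γ|²/ε`, written in terms
of `s = 1/t`. -/
lemma dbar_cutoff (ha : IsSymbol k fun s => χ (ENNReal.ofReal s)⁻¹) (hΦ : ContDiff ℝ ∞ Φ)
    (hΦ0 : ∀ z, 0 < Φ z) (hε : 0 < ε) {z : Fin n → ℂ} (hz : ∀ i, z i ≠ 0) (j : Fin n) :
    dbar (cutoff χ Φ γ ε) j z = -(dbarLog Φ j z + γ j * (conj (z j))⁻¹) *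
      euler (fun s => χ (ENNReal.ofReal s)⁻¹) (ε / ‖monom γ z‖ ^ 2 / Φ z) := by
  have hm : monom γ z ≠ 0 := Finset.prod_ne_zero_iff.2 fun j _ => pow_ne_zero _ (hz j)
  have hm0 : 0 < ‖monom γ z‖ := norm_pos_iff.2 hm
  have hp := hΦ0 z
  have dΦ := hΦ.differentiable (by simp) z
  have dm := (contDiff_norm_monom_sq γ).differentiable (by simp) z
  have hev : cutoff χ Φ γ ε =ᶠ[𝓝 z]
      fun z => (fun s => χ (ENNReal.ofReal s)⁻¹) (ε / (Φ z * ‖monom γ z‖ ^ 2)) := by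
    filter_upwards [(continuous_monom γ).continuousAt.eventually_ne hm] with y hy
    rw [cutoff_eq hΦ0 hε hy, div_div, mul_comm (Φ y)]
  have h1 : ∀ w : ℂ, fderiv ℝ (cutoff χ Φ γ ε) z (Pi.single j w) =
      -((fderiv ℝ Φ z (Pi.single j w) / Φ z + 2 * γ j * (w / z j).re : ℝ) : ℂ) *
        euler (fun s => χ (ENNReal.ofReal s)⁻¹) (ε / ‖monom γ z‖ ^ 2 / Φ z) := by
    intro w
    rw [hev.fderiv_eq, fderiv_symbol_comp ha (dΦ.fun_mul dm) (by positivity) hε.le, div_div,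
      mul_comm (‖monom γ z‖ ^ 2), fderiv_fun_mul dΦ dm]
    have h2 : fderiv ℝ (fun z => ‖monom γ z‖ ^ 2) z (Pi.single j w) =
        2 * γ j * (w / z j).re * ‖monom γ z‖ ^ 2 := by
      have hd := ((contDiff_monom γ).differentiable (by simp) z).hasFDerivAt.norm_sq
      rw [hd.fderiv]
      simp only [smul_apply, ContinuousLinearMap.comp_apply, innerSL_apply_apply,
        fderiv_monom γ (hz j), Complex.inner]
      have e : γ j * (w / z j) * monom γ z * conj (monom γ z) =
          ((γ j * ‖monom γ z‖ ^ 2 : ℝ) : ℂ) * (w / z j) := by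
        rw [mul_assoc, Complex.mul_conj, Complex.normSq_eq_norm_sq]; push_cast; ring
      rw [e, Complex.re_ofReal_mul]
      simp only [nsmul_eq_mul]; push_cast; ring
    simp only [add_apply, smul_apply, smul_eq_mul, h2]
    congr 4
    field_simp
    ring
  have h3 : (conj (z j))⁻¹ = ((1 / z j).re : ℂ) + Complex.I * ((Complex.I / z j).re : ℂ) := by
    rw [one_div, div_eq_mul_inv, Complex.I_mul_re, ← map_inv₀]
    apply Complex.ext <;> simp [neg_div]
  rw [dbar, h1, h1, dbarLog, h3]
  push_cast
  ring

/-- The quotient of the cutoff function by `ζ^{kγ}` extends smoothly: if `χ(t) = t^k b(t)`, then it is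
`(Φ ζ̄^γ/ε)^k b(Φ|ζ^γ|²/ε)`. -/
lemma exists_smooth_cutoff_div (hχ : SmoothExt χ) (hk : VanishesToOrder χ k)
    (hΦ : ContDiff ℝ ∞ Φ) (hΦ0 : ∀ z, 0 < Φ z) (γ : Fin n → ℕ) (hε : 0 < ε) :
    ∃ q : (Fin n → ℂ) → ℂ, ContDiff ℝ ∞ q ∧
      ∀ z, monom γ z ≠ 0 → q z = (monom (k • γ) z)⁻¹ * cutoff χ Φ γ ε z := by
  obtain ⟨b, hb, hχb⟩ := hχ.exists_eq_pow_mul hk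
  have ht : ∀ z, 0 ≤ Φ z * ‖monom γ z‖ ^ 2 / ε := fun z =>
    div_nonneg (mul_nonneg (hΦ0 z).le (by positivity)) hε.le
  refine ⟨fun z => (Φ z * conj (monom γ z) / ε) ^ k * b (Φ z * ‖monom γ z‖ ^ 2 / ε),
    ContDiff.mul ?_ ?_, fun z hz => ?_⟩
  · exact (((Complex.ofRealCLM.contDiff.comp hΦ).mul
      (Complex.conjCLE.contDiff.comp (contDiff_monom γ))).div_const _).pow k
  · exact hb.comp_contDiff ((hΦ.mul (contDiff_norm_monom_sq γ)).div_const ε) ht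
  · have e : monom (k • γ) z = monom γ z ^ k := by
      simpa [monom] using monom_smul_add k 0 γ 0 z
    have key : Φ z * conj (monom γ z) / ε =
        (monom γ z)⁻¹ * ((Φ z * ‖monom γ z‖ ^ 2 / ε : ℝ) : ℂ) := by
      push_cast
      rw [← Complex.conj_mul']
      field_simp
    rw [cutoff, hχb _ (ht z), e]
    simp only [key, mul_pow, inv_pow, mul_assoc]

lemma dbar_cutoff_div (hχ : SmoothExt χ) (hΦ : ContDiff ℝ ∞ Φ) (hΦ0 : ∀ z, 0 < Φ z)
    (hε : 0 < ε) {q : (Fin n → ℂ) → ℂ}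
    (hq : ∀ z, monom γ z ≠ 0 → q z = (monom (k • γ) z)⁻¹ * cutoff χ Φ γ ε z)
    {z : Fin n → ℂ} (hz : ∀ i, z i ≠ 0) (j : Fin n) :
    dbar q j z = (monom (k • γ) z)⁻¹ * dbar (cutoff χ Φ γ ε) j z := by
  have hm : ∀ γ : Fin n → ℕ, monom γ z ≠ 0 := fun γ =>
    Finset.prod_ne_zero_iff.2 fun j _ => pow_ne_zero _ (hz j)
  have hev : q =ᶠ[𝓝 z] fun z => (monom (k • γ) z)⁻¹ * cutoff χ Φ γ ε z := by
    filter_upwards [(continuous_monom γ).continuousAt.eventually_ne (hm γ)] with y hy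
    exact hq y hy
  have h1 : dbar q j z = dbar (fun z => (monom (k • γ) z)⁻¹ * cutoff χ Φ γ ε z) j z := by
    rw [dbar, hev.fderiv_eq, dbar]
  rw [h1, dbar_mul (((contDiff_monom _).differentiable (by simp) z).fun_inv (hm _))
    ((contDiff_cutoff hχ hΦ hΦ0 hε).differentiable (by simp) z), dbar_inv_monom _ hz, zero_mul,
    zero_add]

lemma hasCompactSupport_of_polydisc {R : ℝ} {u : (Fin n → ℂ) → ℂ}
    (hu : ∀ z ∉ polydisc (Fin n) R, u z = 0) : HasCompactSupport u :=
  HasCompactSupport.intro (isCompact_polydisc R) hu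

lemma integrable_dbar {u : (Fin n → ℂ) → ℂ} (hu : ContDiff ℝ ∞ u) {R : ℝ}
    (hR : ∀ z ∉ polydisc (Fin n) R, u z = 0) (j : Fin n) : Integrable (dbar u j) :=
  (contDiff_dbar hu j).continuous.integrable_of_hasCompactSupport
    (hasCompactSupport_of_polydisc fun _ hz => dbar_eq_zero_of_notMem hR j hz)

lemma integral_dbar_eq_zero {u : (Fin n → ℂ) → ℂ} (hu : ContDiff ℝ ∞ u) {R : ℝ}
    (hR : ∀ z ∉ polydisc (Fin n) R, u z = 0) (j : Fin n) : ∫ z, dbar u j z = 0 := by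
  have hi : ∀ w, Integrable fun z => fderiv ℝ u z w := fun w =>
    (contDiff_fderiv_single hu w).continuous.integrable_of_hasCompactSupport
      (hasCompactSupport_of_polydisc fun z hz => by rw [fderiv_eq_zero_of_notMem hR hz]; rfl)
  have h0 : ∀ w, ∫ z, fderiv ℝ u z w = 0 := by
    intro w
    have hu' : Integrable u :=
      hu.continuous.integrable_of_hasCompactSupport (hasCompactSupport_of_polydisc hR)
    have := integral_mul_fderiv_eq_neg_fderiv_mul_of_integrable
      (μ := (volume : Measure (Fin n → ℂ))) (f := fun _ => (1 : ℂ)) (g := u) (v := w)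
      (by simp) (by simpa using hi w) (by simpa using hu') (by simp)
      (fun z _ => hu.differentiable (by simp) z)
    simpa using this
  simp only [dbar]
  rw [integral_div, integral_add (hi _) ((hi _).const_mul _), integral_const_mul, h0, h0]
  simp

end Parts

/-! ### Regularized residues -/

section Main

variable {n : ℕ}

lemma wedge_dlogBar (φ : TestForm (Fin n)) (j : Fin n) (z : Fin n → ℂ) :
    wedge (dlogBar j) φ z = (conj (z j))⁻¹ * φ.coeff j z := by
  simp [wedge, dlogBar]

lemma exists_polydisc_of_hasCompactSupport {κ : Type*} [Finite κ] {u : κ → (Fin n → ℂ) → ℂ}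
    (hu : ∀ i, HasCompactSupport (u i)) : ∃ R, ∀ i, ∀ z ∉ polydisc (Fin n) R, u i z = 0 := by
  have hb : Bornology.IsBounded (⋃ i, tsupport (u i)) :=
    Bornology.isBounded_iUnion.2 fun i => (hu i).isCompact.isBounded
  obtain ⟨R, hR⟩ := hb.exists_norm_le
  refine ⟨R, fun i z hz => ?_⟩
  by_contra h
  exact hz fun j => (norm_le_pi_norm z j).trans
    (hR z (mem_iUnion.2 ⟨i, subset_tsupport _ h⟩))

lemma mul_lt_one_of_lt_inv_mlength {γ : Fin n → ℕ} {r : ℝ≥0}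
    (h : 2 * (r : ℝ≥0∞) < (ENNReal.ofReal (mlength γ))⁻¹) (j : Fin n) : (r : ℝ) * γ j < 1 := by
  rcases Nat.eq_zero_or_pos (γ j) with h0 | h0
  · simp [h0]
  have hle : (γ j : ℝ) ≤ mlength γ := by
    refine Real.le_sqrt_of_sq_le ?_
    exact Finset.single_le_sum (f := fun j => (γ j : ℝ) ^ 2) (fun i _ => by positivity)
      (Finset.mem_univ j)
  have hpos : 0 < mlength γ := lt_of_lt_of_le (by exact_mod_cast h0) hle
  rw [← ENNReal.ofReal_inv_of_pos hpos] at h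
  have h2 : 2 * (r : ℝ) < (mlength γ)⁻¹ := by
    have e : 2 * (r : ℝ≥0∞) = ENNReal.ofReal (2 * (r : ℝ)) := by
      rw [ENNReal.ofReal_mul zero_le_two, ENNReal.ofReal_coe_nnreal]; simp
    rw [e] at h
    exact (ENNReal.ofReal_lt_ofReal_iff (by positivity)).1 h
  have h3 : 2 * (r : ℝ) * mlength γ < 1 := by
    rwa [← one_div, lt_div_iff₀ hpos] at h2
  nlinarith [r.coe_nonneg]

lemma holderOnWith_of_norm_sub_le {F : ℝ × ℝ → ℂ} {C : ℝ} {r : ℝ≥0} (hC : 0 ≤ C)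
    (h : ∀ ε ε' : ℝ × ℝ, 0 ≤ ε → 0 ≤ ε' →
      ‖F ε - F ε'‖ ≤ C * (|ε.1 - ε'.1| ^ (r : ℝ) + |ε.2 - ε'.2| ^ (r : ℝ))) :
    HolderOnWith (2 * C).toNNReal r F (Ici 0 ×ˢ Ici 0) := by
  intro x hx y hy
  have h1 : |x.1 - y.1| ≤ dist x y := by rw [← Real.dist_eq]; exact le_max_left _ _
  have h2 : |x.2 - y.2| ≤ dist x y := by rw [← Real.dist_eq]; exact le_max_right _ _
  have h3 : dist (F x) (F y) ≤ 2 * C * dist x y ^ (r : ℝ) := by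
    rw [dist_eq_norm]
    calc _ ≤ C * (dist x y ^ (r : ℝ) + dist x y ^ (r : ℝ)) := by
          refine (h x y ⟨hx.1, hx.2⟩ ⟨hy.1, hy.2⟩).trans ?_
          gcongr
      _ = _ := by ring
  rw [edist_dist, edist_dist, ENNReal.ofReal_rpow_of_nonneg dist_nonneg r.coe_nonneg]
  refine (ENNReal.ofReal_le_ofReal h3).trans (le_of_eq ?_)
  rw [ENNReal.ofReal_mul (by positivity)]
  rfl

/-- The decomposition of the integrand of the regularized residue, valid off the coordinate
hyperplanes. The derivative of the second cutoff function is written out for the variables `ζ_j`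
in `p`, and moved to the other factors for the remaining variables, on which `ζ^α` does not depend;
the functions `q₁`, `q₂` are the smooth extensions of the cutoff functions divided by `ζ^{kα}` and
`ζ^{lβ}`. -/
lemma integrand_eq {k l : ℕ} {χ₁ χ₂ : ℝ≥0∞ → ℂ} (hχ₁ : SmoothExt χ₁) (hχ₂ : SmoothExt χ₂)
    (hk : VanishesToOrder χ₁ k) (hl : VanishesToOrder χ₂ l) {α β : Fin n → ℕ} {Φ Ψ : (Fin n → ℂ) → ℝ}
    (hΦ : ContDiff ℝ ∞ Φ) (hΨ : ContDiff ℝ ∞ Ψ) (hΦ0 : ∀ z, 0 < Φ z) (hΨ0 : ∀ z, 0 < Ψ z)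
    (φ : TestForm (Fin n)) (p : Fin n → Prop) [DecidablePred p] (hp : ∀ j, ¬ p j → α j = 0)
    {h : {j // p j} → (Fin n → ℂ) → ℂ}
    (hh : ∀ (j : {j // p j}) (z : Fin n → ℂ), (∀ i, z i ≠ 0) →
      β j * ((conj (z j))⁻¹ * φ.coeff j z) = β j * h j z)
    {ε : ℝ × ℝ} (hε₁ : 0 < ε.1) (hε₂ : 0 < ε.2) {q₁ q₂ : (Fin n → ℂ) → ℂ}
    (hq₁c : ContDiff ℝ ∞ q₁) (hq₂c : ContDiff ℝ ∞ q₂)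
    (hq₁ : ∀ z, monom α z ≠ 0 → q₁ z = (monom (k • α) z)⁻¹ * cutoff χ₁ Φ α ε.1 z)
    (hq₂ : ∀ z, monom β z ≠ 0 → q₂ z = (monom (l • β) z)⁻¹ * cutoff χ₂ Ψ β ε.2 z)
    {z : Fin n → ℂ} (hz : ∀ i, z i ≠ 0) :
    integrand χ₁ χ₂ k l Φ Ψ α β φ ε z =
      regIntegrand Φ Ψ (fun s => χ₁ (ENNReal.ofReal s)⁻¹) (euler fun s => χ₂ (ENNReal.ofReal s)⁻¹)
        (fun z => -∑ j : {j // p j}, (dbarLog Ψ j z * φ.coeff j z + β j * h j z)) k l α β ε z +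
      regIntegrand Φ Ψ (euler fun s => χ₁ (ENNReal.ofReal s)⁻¹) (fun s => χ₂ (ENNReal.ofReal s)⁻¹)
        (fun z => ∑ j : {j // ¬ p j}, dbarLog Φ j z * φ.coeff j z) k l α β ε z -
      regIntegrand Φ Ψ (fun s => χ₁ (ENNReal.ofReal s)⁻¹) (fun s => χ₂ (ENNReal.ofReal s)⁻¹)
        (fun z => ∑ j : {j // ¬ p j}, dbar (φ.coeff j) j z) k l α β ε z +
      ∑ j : {j // ¬ p j}, dbar (fun z => q₁ z * q₂ z * φ.coeff j z) j z := by
  have hm : ∀ γ : Fin n → ℕ, monom γ z ≠ 0 := fun γ =>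
    Finset.prod_ne_zero_iff.2 fun j _ => pow_ne_zero _ (hz j)
  have e₁ : monom (k • α) z = monom α z ^ k := by
    simpa [monom] using monom_smul_add k 0 α 0 z
  have e₂ : monom (l • β) z = monom β z ^ l := by
    simpa [monom] using monom_smul_add l 0 β 0 z
  have d₁ := hq₁c.differentiable (by simp) z
  have d₂ := hq₂c.differentiable (by simp) z
  have hG : ∀ j : {j // ¬ p j}, dbar (fun z => q₁ z * q₂ z * φ.coeff j z) j z =
      dbar q₁ j z * q₂ z * φ.coeff j z + q₁ z * dbar q₂ j z * φ.coeff j z +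
        q₁ z * q₂ z * dbar (φ.coeff j) j z := by
    intro j
    rw [dbar_mul (d₁.fun_mul d₂) ((φ.smooth j).differentiable (by simp) z), dbar_mul d₁ d₂]
    ring
  have b₁ := fun j => dbar_cutoff (γ := α) (hχ₁.isSymbol hk) hΦ hΦ0 hε₁ hz j
  have b₂ := fun j => dbar_cutoff (γ := β) (hχ₂.isSymbol hl) hΨ hΨ0 hε₂ hz j
  have c₁ := fun j => dbar_cutoff_div hχ₁ hΦ hΦ0 hε₁ hq₁ hz j
  have c₂ := fun j => dbar_cutoff_div hχ₂ hΨ hΨ0 hε₂ hq₂ hz j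
  simp only [hG, c₁, c₂, hq₁ z (hm α), hq₂ z (hm β), integrand, wedge, regIntegrand, ampl, scale,
    monom_smul_add, cutoff_eq hΦ0 hε₁ (hm α), cutoff_eq hΨ0 hε₂ (hm β), e₁, e₂]
  rw [← Fintype.sum_subtype_add_sum_subtype p]
  simp only [neg_mul, mul_neg, one_div, mul_inv, Finset.sum_mul, Finset.mul_sum, mul_add,
    ← Finset.sum_neg_distrib]
  rw [add_sub_assoc, add_assoc, ← Finset.sum_sub_distrib, ← Finset.sum_add_distrib]
  congr 1
  · refine Finset.sum_congr rfl fun j _ => ?_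
    rw [b₂, ← hh j z hz]
    ring
  · refine Finset.sum_congr rfl fun j _ => ?_
    rw [b₁, hp j j.2]
    simp only [Nat.cast_zero, zero_mul, add_zero]
    ring

end Main

end ResidueReg

open ResidueReg

theorem mainTheorem9 (n k l : ℕ) (χ₁ χ₂ : ℝ≥0∞ → ℂ)
    (hχ₁ : ResidueReg.SmoothExt χ₁) (hχ₂ : ResidueReg.SmoothExt χ₂)
    (hk : ResidueReg.VanishesToOrder χ₁ k) (hl : ResidueReg.VanishesToOrder χ₂ l)
    (hχ₁_top : χ₁ ⊤ = 1) (hχ₂_top : χ₂ ⊤ = 1)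
    (α' α'' β' β'' : Fin n → ℕ)
    (hαα : Disjoint (Function.support α') (Function.support α''))
    (hαβ : Disjoint (Function.support α') (Function.support β'))
    (hαβ' : Disjoint (Function.support α'') (Function.support β'))
    (hsupp : ∀ j, α'' j = 0 ↔ β'' j = 0)
    (φ : ResidueReg.TestForm (Fin n))
    (hφ : ∀ j, α'' j ≠ 0 → ResidueReg.DlogBarWedgeIsTest φ j)
    (Φ Ψ : (Fin n → ℂ) → ℝ) (hΦ : ContDiff ℝ ∞ Φ) (hΨ : ContDiff ℝ ∞ Ψ)
    (hΦ_pos : ∀ z, 0 < Φ z) (hΨ_pos : ∀ z, 0 < Ψ z) :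
    (∀ ε : ℝ × ℝ, 0 < ε.1 → 0 < ε.2 →
      Integrable (ResidueReg.integrand χ₁ χ₂ k l Φ Ψ (α' + α'') (β' + β'') φ ε)) ∧
    ∃ L : ℂ,
      ResidueReg.HasTensorResidue (fun j => β' j = 0) (k • (α' + α'') + l • β'') (l • β') φ L ∧
      Tendsto
        (fun ε : ℝ × ℝ =>
          ∫ z, ResidueReg.integrand χ₁ χ₂ k l Φ Ψ (α' + α'') (β' + β'') φ ε z)
        (𝓝[>] 0 ×ˢ 𝓝[>] 0) (𝓝 L) ∧
      ∃ F : ℝ × ℝ → ℂ,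
        (∀ ε : ℝ × ℝ, 0 < ε.1 → 0 < ε.2 →
          F ε = ∫ z, ResidueReg.integrand χ₁ χ₂ k l Φ Ψ (α' + α'') (β' + β'') φ ε z) ∧
        F (0, 0) = L ∧
        ∀ r : ℝ≥0, 0 < r → r ≤ 1 →
          2 * (r : ℝ≥0∞) < min (ENNReal.ofReal (ResidueReg.mlength (α' + α'')))⁻¹
            (ENNReal.ofReal (ResidueReg.mlength (β' + β'')))⁻¹ →
          ∃ C : ℝ≥0, HolderOnWith C r F (Ici 0 ×ˢ Ici 0) := by
  set α := α' + α'' with hα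
  set β := β' + β'' with hβ
  set p : Fin n → Prop := fun j => β' j = 0
  have hα0 : ∀ j, ¬ p j → α j = 0 ∧ β'' j = 0 := by
    intro j hj
    have h1 : α' j = 0 := by
      by_contra h
      exact Set.disjoint_left.1 hαβ (Function.mem_support.2 h) (Function.mem_support.2 hj)
    have h2 : α'' j = 0 := by
      by_contra h
      exact Set.disjoint_left.1 hαβ' (Function.mem_support.2 h) (Function.mem_support.2 hj)
    exact ⟨by simp [hα, h1, h2], (hsupp j).1 h2⟩
  -- the smooth functions `φ_j/ζ̄_j`, for `j` in the common support of `α''` and `β''`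
  have hex : ∀ j : {j // p j}, ∃ h : (Fin n → ℂ) → ℂ, IsTopTestForm h ∧
      ∀ z : Fin n → ℂ, (∀ i, z i ≠ 0) →
        β j * ((conj (z j))⁻¹ * φ.coeff j z) = β j * h z := by
    intro j
    by_cases hj : α'' j = 0
    · refine ⟨fun _ => 0, ⟨contDiff_const, HasCompactSupport.zero⟩, fun z _ => ?_⟩
      have : β j = 0 := by simp [hβ, show β' j = 0 from j.2, (hsupp j).1 hj]
      simp [this]
    · obtain ⟨h, hh, hhz⟩ := hφ j hj
      exact ⟨h, hh, fun z hz => by rw [hhz z (hz j), wedge_dlogBar]⟩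
  choose h hh hhz using hex
  obtain ⟨R, hR⟩ := exists_polydisc_of_hasCompactSupport
    (u := Sum.elim φ.coeff h) (by
      rintro (j | j)
      · exact φ.compact j
      · exact (hh j).2)
  have hφR : ∀ j, ∀ z ∉ polydisc (Fin n) R, φ.coeff j z = 0 := fun j => hR (Sum.inl j)
  have hhR : ∀ j, ∀ z ∉ polydisc (Fin n) R, h j z = 0 := fun j => hR (Sum.inr j)
  -- the group of `N`-th roots of unity is large enough to separate the weights that occur
  set N : ℕ := 2 * (∑ j, (k • α + l • β) j) + 1 with hNdef
  have hN : ∀ j, 2 * (k • α + l • β) j ≤ N := fun j => by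
    have := Finset.single_le_sum (f := fun j => (k • α + l • β) j) (fun i _ => Nat.zero_le _)
      (Finset.mem_univ j)
    omega
  set a₁ : ℝ → ℂ := fun s => χ₁ (ENNReal.ofReal s)⁻¹ with ha₁
  set a₂ : ℝ → ℂ := fun s => χ₂ (ENNReal.ofReal s)⁻¹ with ha₂
  have h₁ : IsSymbol k a₁ := hχ₁.isSymbol hk
  have h₂ : IsSymbol l a₂ := hχ₂.isSymbol hl
  set fA : (Fin n → ℂ) → ℂ := fun z =>
    -∑ j : {j // p j}, (dbarLog Ψ j z * φ.coeff j z + β j * h j z) with hfA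
  set fB : (Fin n → ℂ) → ℂ := fun z =>
    ∑ j : {j // ¬ p j}, dbarLog Φ j z * φ.coeff j z with hfB
  set fC : (Fin n → ℂ) → ℂ := fun z => ∑ j : {j // ¬ p j}, dbar (φ.coeff j) j z with hfC
  have cA : ContDiff ℝ ∞ fA := (ContDiff.sum fun (j : {j // p j}) _ =>
    ((contDiff_dbarLog hΨ hΨ_pos (j : Fin n)).mul (φ.smooth j)).add (contDiff_const.mul (hh j).1)).neg
  have cB : ContDiff ℝ ∞ fB := ContDiff.sum fun j _ =>
    (contDiff_dbarLog hΦ hΦ_pos j).mul (φ.smooth j)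
  have cC : ContDiff ℝ ∞ fC := ContDiff.sum fun j _ => contDiff_dbar (φ.smooth j) j
  have sA : ∀ z ∉ polydisc (Fin n) R, fA z = 0 := fun z hz => by
    simp only [hfA, hφR _ z hz, hhR _ z hz, mul_zero, add_zero, Finset.sum_const_zero, neg_zero]
  have sB : ∀ z ∉ polydisc (Fin n) R, fB z = 0 := fun z hz => by
    simp only [hfB, hφR _ z hz, mul_zero, Finset.sum_const_zero]
  have sC : ∀ z ∉ polydisc (Fin n) R, fC z = 0 := fun z hz =>
    Finset.sum_eq_zero fun j _ => dbar_eq_zero_of_notMem (hφR j) j hz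
  set F : ℝ × ℝ → ℂ := fun ε => regIntegral N R Φ Ψ a₁ (euler a₂) fA k l α β ε +
    regIntegral N R Φ Ψ (euler a₁) a₂ fB k l α β ε - regIntegral N R Φ Ψ a₁ a₂ fC k l α β ε with hF
  have hmain : ∀ ε : ℝ × ℝ, 0 < ε.1 → 0 < ε.2 →
      Integrable (integrand χ₁ χ₂ k l Φ Ψ α β φ ε) ∧
      F ε = ∫ z, integrand χ₁ χ₂ k l Φ Ψ α β φ ε z := by
    intro ε hε₁ hε₂
    obtain ⟨q₁, hq₁c, hq₁⟩ := exists_smooth_cutoff_div hχ₁ hk hΦ hΦ_pos α hε₁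
    obtain ⟨q₂, hq₂c, hq₂⟩ := exists_smooth_cutoff_div hχ₂ hl hΨ hΨ_pos β hε₂
    have iA := integrable_regIntegrand hΦ hΨ hΦ_pos hΨ_pos h₁ h₂.euler cA sA α β hε₁ hε₂
    have iB := integrable_regIntegrand hΦ hΨ hΦ_pos hΨ_pos h₁.euler h₂ cB sB α β hε₁ hε₂
    have iC := integrable_regIntegrand hΦ hΨ hΦ_pos hΨ_pos h₁ h₂ cC sC α β hε₁ hε₂
    have cG : ∀ j, ContDiff ℝ ∞ fun z => q₁ z * q₂ z * φ.coeff j z := fun j =>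
      (hq₁c.mul hq₂c).mul (φ.smooth j)
    have sG : ∀ j, ∀ z ∉ polydisc (Fin n) R, q₁ z * q₂ z * φ.coeff j z = 0 := fun j z hz => by
      rw [hφR j z hz, mul_zero]
    have iG : ∀ j : {j // ¬ p j}, Integrable (dbar (fun z => q₁ z * q₂ z * φ.coeff j z) j) :=
      fun j => integrable_dbar (cG j) (sG j) j
    have hae : integrand χ₁ χ₂ k l Φ Ψ α β φ ε =ᵐ[volume] fun z =>
        regIntegrand Φ Ψ a₁ (euler a₂) fA k l α β ε z +
          regIntegrand Φ Ψ (euler a₁) a₂ fB k l α β ε z -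
          regIntegrand Φ Ψ a₁ a₂ fC k l α β ε z +
          ∑ j : {j // ¬ p j}, dbar (fun z => q₁ z * q₂ z * φ.coeff j z) j z := by
      have hne : ∀ᵐ z : Fin n → ℂ, ∀ i, z i ≠ 0 :=
        ae_all_iff.2 fun j => Measure.ae_eval_ne _ j 0
      filter_upwards [hne] with z hz
      exact integrand_eq hχ₁ hχ₂ hk hl hΦ hΨ hΦ_pos hΨ_pos φ p (fun j hj => (hα0 j hj).1) hhz
        hε₁ hε₂ hq₁c hq₂c hq₁ hq₂ hz
    have iS : Integrable fun z =>
        ∑ j : {j // ¬ p j}, dbar (fun z => q₁ z * q₂ z * φ.coeff j z) j z :=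
      integrable_finsetSum _ fun j _ => iG j
    have iAB : Integrable fun z => regIntegrand Φ Ψ a₁ (euler a₂) fA k l α β ε z +
        regIntegrand Φ Ψ (euler a₁) a₂ fB k l α β ε z := iA.add iB
    have iABC : Integrable fun z => regIntegrand Φ Ψ a₁ (euler a₂) fA k l α β ε z +
        regIntegrand Φ Ψ (euler a₁) a₂ fB k l α β ε z -
        regIntegrand Φ Ψ a₁ a₂ fC k l α β ε z := iAB.sub iC
    refine ⟨(iABC.add iS).congr hae.symm, ?_⟩
    rw [integral_congr_ae hae, integral_add iABC iS, integral_sub iAB iC, integral_add iA iB, integral_finsetSum _ fun j _ => iG j,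
      integral_regIntegrand N hΦ hΨ hΦ_pos hΨ_pos h₁ h₂.euler cA sA α β hε₁ hε₂,
      integral_regIntegrand N hΦ hΨ hΦ_pos hΨ_pos h₁.euler h₂ cB sB α β hε₁ hε₂,
      integral_regIntegrand N hΦ hΨ hΦ_pos hΨ_pos h₁ h₂ cC sC α β hε₁ hε₂]
    simp only [integral_dbar_eq_zero (cG _) (sG _), Finset.sum_const_zero, add_zero, hF]
  have hhol : ∀ r : ℝ≥0, r ≤ 1 → (∀ j, (r : ℝ) * α j < 1) → (∀ j, (r : ℝ) * β j < 1) →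
      ∃ C : ℝ≥0, HolderOnWith C r F (Ici 0 ×ˢ Ici 0) := by
    intro r hr1 hrα hrβ
    have hr1' : (r : ℝ) ≤ 1 := by exact_mod_cast hr1
    obtain ⟨A, hA0, hA⟩ := exists_regIntegral_holder N hΦ hΨ hΦ_pos hΨ_pos h₁ h₂.euler cA R hN
      r.coe_nonneg hr1' hrα hrβ
    obtain ⟨B, hB0, hB⟩ := exists_regIntegral_holder N hΦ hΨ hΦ_pos hΨ_pos h₁.euler h₂ cB R hN
      r.coe_nonneg hr1' hrα hrβ
    obtain ⟨C, hC0, hC⟩ := exists_regIntegral_holder N hΦ hΨ hΦ_pos hΨ_pos h₁ h₂ cC R hN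
      r.coe_nonneg hr1' hrα hrβ
    refine ⟨_, holderOnWith_of_norm_sub_le (C := A + B + C) (by positivity)
      fun ε ε' hε hε' => ?_⟩
    rw [hF]
    simp only
    rw [sub_sub_sub_comm, add_sub_add_comm, add_mul, add_mul]
    exact (norm_sub_le _ _).trans (add_le_add ((norm_add_le _ _).trans
      (add_le_add (hA ε ε' hε hε') (hB ε ε' hε hε'))) (hC ε ε' hε hε'))
  have hF0 : F (0, 0) = -∫ z in polydisc (Fin n) R, torusMean N (k • α + l • β) fC z := by
    have e : ((0, 0) : ℝ × ℝ) = 0 := rfl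
    have e₁ : a₁ 0 = 1 := by simp [ha₁, hχ₁_top]
    have e₂ : a₂ 0 = 1 := by simp [ha₂, hχ₂_top]
    have z₁ : euler a₁ 0 = 0 := by simp [euler]
    have z₂ : euler a₂ 0 = 0 := by simp [euler]
    rw [hF, e]
    simp only [regIntegral_zero, e₁, e₂, z₁, z₂]
    ring
  refine ⟨fun ε hε₁ hε₂ => (hmain ε hε₁ hε₂).1, F (0, 0), ?_, ?_, F,
    fun ε hε₁ hε₂ => (hmain ε hε₁ hε₂).2, rfl, fun r _ hr1 hr => ?_⟩
  · rw [hF0]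
    refine hasTensorResidue_torusMean p N hN (fun j hj => ?_) (fun j hj => ?_) φ hφR
    · simp [hβ, show β' j = 0 from hj]
    · simp [hβ, hα0 j hj]
  · -- some positive exponent is admissible, so that `F` is continuous at `(0, 0)`
    obtain ⟨C, hC⟩ : ∃ C : ℝ≥0, HolderOnWith C (1 / (1 + ∑ j, (α j : ℝ≥0) + ∑ j, (β j : ℝ≥0))) F
        (Ici 0 ×ˢ Ici 0) := by
      have hle : ∀ γ : Fin n → ℕ, ∀ j, (γ j : ℝ) ≤ ∑ j, (γ j : ℝ) := fun γ j =>
        Finset.single_le_sum (f := fun j => (γ j : ℝ)) (fun i _ => by positivity)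
          (Finset.mem_univ j)
      have hnn : ∀ γ : Fin n → ℕ, 0 ≤ ∑ j, (γ j : ℝ) := fun γ => by positivity
      refine hhol _ ?_ (fun j => ?_) (fun j => ?_)
      · refine div_le_one_of_le₀ ?_ (by positivity)
        rw [add_assoc]; exact le_self_add
      · push_cast
        rw [one_div, inv_mul_lt_iff₀ (by positivity), mul_one]
        linarith [hle α j, hnn β]
      · push_cast
        rw [one_div, inv_mul_lt_iff₀ (by positivity), mul_one]
        linarith [hle β j, hnn α]
    have hcont : ContinuousWithinAt F (Ici 0 ×ˢ Ici 0) (0, 0) :=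
      (hC.uniformContinuousOn (by positivity)).continuousOn (0, 0) (by simp)
    rw [← nhdsWithin_prod_eq]
    refine ((hcont.mono (prod_mono Ioi_subset_Ici_self Ioi_subset_Ici_self)).tendsto).congr' ?_
    filter_upwards [self_mem_nhdsWithin] with ε hε
    exact (hmain ε hε.1 hε.2).2
  · exact hhol r hr1 (mul_lt_one_of_lt_inv_mlength (hr.trans_le (min_le_left _ _)))
      (mul_lt_one_of_lt_inv_mlength (hr.trans_le (min_le_right _ _)))
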